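/- Theorem (Q-aggregation with a plug-in nuisance estimate). Let $Z$ be a random observation with law $P$ (write $Ph=\mathbb E[h(Z)]$), $X=X(Z)$ a covariate, $f_1,\dots,f_M$ real-valued measurable candidate functions of $X$, and $f_\theta=\sum_j\theta_jf_j$ for $\theta$ in the simplex $\Theta=\{\theta\in\mathbb R_{\ge0}^M:\sum_j\theta_j=1\}$, with vertices $e_1,\dots,e_M$; put $\|f-f'\|^2=P(f(X)-f'(X))^2$. Let $\ell(Z;u,g)$ be a loss depending on a prediction $u\in\mathbb R$ and a nuisance parameter $g$, with true value $g_0$, and let $\hat g$ be a fixed value of the nuisance parameter (an estimate trained on a separate sample, on which one conditions). Write $\ell_{\theta,g}(Z)=\ell(Z;f_\theta(X),g)$, $R(\theta,g)=P\ell_{\theta,g}$ and, for $\nu\in[0,1]$, $$\tilde\ell_{\theta,g}(Z)=(1-\nu)\,\ell_{\theta,g}(Z)+\nu\sum_{j=1}^M\theta_j\,\ell_{e_j,g}(Z).$$ Let $\pi_1,\dots,\pi_M>0$ with $\sum_j\pi_j=1$ be prior weights, and let $Z_1,\dots,Z_n$ ($n\ge1$) be i.i.d. with law $P$. Let $\hat\theta$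 be any minimizer over $\Theta$ of $$\theta\mapsto\frac1n\sum_{i=1}^n\tilde\ell_{\theta,\hat g}(Z_i)+\frac\beta n\sum_{j=1}^M\theta_j\log\frac1{\pi_j}.$$ Assume that $\ell_{\theta,g_0}$ is integrable for every $\theta\in\Theta$, and: (a) for some $\gamma\in[0,1]$ and $\mathrm{Error}(\hat g)\ge0$, for all $\theta,\theta'\in\Theta$, $$P(\tilde\ell_{\theta,g_0}-\tilde\ell_{\theta',g_0})-P(\tilde\ell_{\theta,\hat g}-\tilde\ell_{\theta',\hat g})\le\mathrm{Error}(\hat g)\,\|f_\theta-f_{\theta'}\|^\gamma$$ (with $0^0=1$); (b) $\ell(\cdot\,;\cdot,g_0)$ is $\sigma$-strongly convex in expectation, $\sigma>0$: for all $f,f'$ in the convex hull of $\{f_1,\dots,f_M\}$, almost surely $u\mapsto\ell(Z;u,g_0)$ is differentiable at $f(X)$, the expectations below exist, and $$P\big(\ell(Z;f'(X),g_0)-\ell(Z;f(X),g_0)\big)\ge P\big[\partial_u\ell(Z;f(X),g_0)\,(f'(X)-f(X))\big]+\tfrac\sigma2\|f-f'\|^2;$$ (c) almost surely, for all $\theta,\theta'\in\Theta$,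 $|\ell_{\theta,\hat g}(Z)-\ell_{\theta',\hat g}(Z)|\le C_b(\hat g)\,|f_\theta(X)-f_{\theta'}(X)|$ (with $C_b(\hat g)\ge0$), $|\ell_{\theta,\hat g}(Z)|\le b$, and $|f_j(X)|\le b$ for every $j$. Let $0<\mu\le\min\{\nu,1-\nu\}\,\frac{\sigma}{14}$ and, with $C_b=C_b(\hat g)$, $$\beta\ge\max\Big\{\frac{8C_b^2(1-\nu)^2}{\mu},\ 8\sqrt3\,b\,C_b(1-\nu),\ \frac{2C_b\,\nu(\nu C_b+\mu b)}{\mu}\Big\}.$$ Then there is a universal constant $C>0$ (independent of all the data and parameters above) such that, for every $\delta\in(0,1)$, with probability at least $1-\delta$, $$R(\hat\theta,g_0)\le\min_{1\le j\le M}\Big(R(e_j,g_0)+\frac\beta n\log\frac1{\pi_j}\Big)+C\,\frac{\log(1/\delta)\,\max\{\frac1\mu C_b(\hat g)^2,\ b\,C_b(\hat g)\}}{n}+2\Big(\frac1\mu\Big)^{\frac\gamma{2-\gamma}}\mathrm{Error}(\hat g)^{\frac2{2-\gamma}}.$$ -/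

import Mathlib

open MeasureTheory ProbabilityTheory

namespace QAgg

noncomputable section

/-- The combination `f_θ = ∑ j, θ j • f j` of the candidate functions. -/
def ensemble {𝒳 : Type*} {M : ℕ} (f : Fin M → 𝒳 → ℝ) (θ : Fin M → ℝ) (x : 𝒳) : ℝ :=
  ∑ j, θ j * f j x

/-- The vertex `e_j` of the simplex of weights. -/
def vertex {M : ℕ} (j : Fin M) : Fin M → ℝ := Pi.single j 1

/-- `ℓ_{θ,g}(z) = ℓ(z; f_θ(X(z)), g)`; the covariate `X` is a function of the observation. -/
def lossAt {𝒵 𝒳 𝒢 : Type*} {M : ℕ} (X : 𝒵 → 𝒳) (l : 𝒵 → ℝ → 𝒢 → ℝ) (f : Fin M → 𝒳 → ℝ)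
    (θ : Fin M → ℝ) (g : 𝒢) (z : 𝒵) : ℝ :=
  l z (ensemble f θ (X z)) g

/-- The mixed loss `(1 - ν) ℓ_{θ,g} + ν ∑ j, θ j ℓ_{e_j,g}`. -/
def mixedLoss {𝒵 𝒳 𝒢 : Type*} {M : ℕ} (X : 𝒵 → 𝒳) (l : 𝒵 → ℝ → 𝒢 → ℝ) (f : Fin M → 𝒳 → ℝ)
    (ν : ℝ) (θ : Fin M → ℝ) (g : 𝒢) (z : 𝒵) : ℝ :=
  (1 - ν) * lossAt X l f θ g z + ν * ∑ j, θ j * lossAt X l f (vertex j) g z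

/-- The risk `R(θ, g) = P ℓ_{θ,g}`. -/
def risk {𝒵 𝒳 𝒢 : Type*} [MeasurableSpace 𝒵] {M : ℕ} (P : Measure 𝒵) (X : 𝒵 → 𝒳)
    (l : 𝒵 → ℝ → 𝒢 → ℝ) (f : Fin M → 𝒳 → ℝ) (θ : Fin M → ℝ) (g : 𝒢) : ℝ :=
  ∫ z, lossAt X l f θ g z ∂P

/-- The distance `‖f_θ - f_θ'‖`, where `‖h‖² = P h(X)²`. -/
def ensembleDist {𝒵 𝒳 : Type*} [MeasurableSpace 𝒵] {M : ℕ} (P : Measure 𝒵) (X : 𝒵 → 𝒳)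
    (f : Fin M → 𝒳 → ℝ) (θ θ' : Fin M → ℝ) : ℝ :=
  Real.sqrt (∫ z, (ensemble f θ (X z) - ensemble f θ' (X z)) ^ 2 ∂P)

/-- `σ`-strong convexity in expectation, at the nuisance value `g`, of the loss in the prediction,
over the convex hull of the candidates: the loss is differentiable in the prediction and
`P (ℓ(Z; f'(X), g) - ℓ(Z; f(X), g)) ≥ P ∂ℓ(Z; f(X), g) (f'(X) - f(X)) + σ / 2 * ‖f' - f‖²`. -/
def StronglyConvexInExpectation {𝒵 𝒳 𝒢 : Type*} [MeasurableSpace 𝒵] {M : ℕ} (P : Measure 𝒵)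
    (X : 𝒵 → 𝒳) (l : 𝒵 → ℝ → 𝒢 → ℝ) (f : Fin M → 𝒳 → ℝ) (σ : ℝ) (g : 𝒢) : Prop :=
  ∀ θ ∈ stdSimplex ℝ (Fin M), ∀ θ' ∈ stdSimplex ℝ (Fin M),
    (∀ᵐ z ∂P, DifferentiableAt ℝ (fun u => l z u g) (ensemble f θ (X z))) ∧
    Integrable (fun z => deriv (fun u => l z u g) (ensemble f θ (X z)) *
      (ensemble f θ' (X z) - ensemble f θ (X z))) P ∧
    ∫ z, deriv (fun u => l z u g) (ensemble f θ (X z)) *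
        (ensemble f θ' (X z) - ensemble f θ (X z)) ∂P
      + σ / 2 * ensembleDist P X f θ' θ ^ 2
      ≤ ∫ z, (lossAt X l f θ' g z - lossAt X l f θ g z) ∂P

/-- The Q-aggregation objective on the sample `s`:
`(1 / n) ∑ i, mixedLoss θ g (s i) + (β / n) ∑ j, θ j log (1 / π j)`. -/
def qObjective {𝒵 𝒳 𝒢 : Type*} {M n : ℕ} (X : 𝒵 → 𝒳) (l : 𝒵 → ℝ → 𝒢 → ℝ)
    (f : Fin M → 𝒳 → ℝ) (ν β : ℝ) (π : Fin M → ℝ) (g : 𝒢) (s : Fin n → 𝒵)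
    (θ : Fin M → ℝ) : ℝ :=
  (1 / (n : ℝ)) * ∑ i, mixedLoss X l f ν θ g (s i)
    + β / (n : ℝ) * ∑ j, θ j * Real.log (1 / π j)

/-- `θ` is a Q-aggregation ensemble for the sample `s`: a minimizer of the objective over the
simplex of weights. -/
def IsQAggregate {𝒵 𝒳 𝒢 : Type*} {M n : ℕ} (X : 𝒵 → 𝒳) (l : 𝒵 → ℝ → 𝒢 → ℝ)
    (f : Fin M → 𝒳 → ℝ) (ν β : ℝ) (π : Fin M → ℝ) (g : 𝒢) (s : Fin n → 𝒵)
    (θ : Fin M → ℝ) : Prop :=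
  θ ∈ stdSimplex ℝ (Fin M) ∧
    IsMinOn (qObjective X l f ν β π g s) (stdSimplex ℝ (Fin M)) θ

end

end QAgg

open QAgg

open QAgg

namespace QAgg

/-! Write V(θ) = ∑ θ_j ‖f_j − f_θ‖², K(θ) = ∑ θ_j log(1/π_j) and d = ‖f_θ − f_θ₀‖². Strong convexity
of the true risk pays twice. The mixed risk at θ exceeds R(θ) by at least (νσ/2)V(θ)
(`add_variance_le`). The penalized mixed population risk, with κV added for κ = (19/20)μ, has a
minimizer θ₀ around which it grows at least like ((1−ν)σ/2 − κ)d (`exists_minimizer`). Since V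
vanishes at the vertices, adding κV leaves the values there unchanged, so the minimum is at most the
oracle value.

The stochastic input is one localized deviation bound, uniform over the simplex
(`measure_excess_le`): outside an event of measure δ, the deviation of the mixed-loss increment from
θ₀ to θ is at most a multiple of μ(V(θ) + d + V(θ₀)) plus (τ/n)(K(θ) + log(1/δ)). The part ℓ_θ is
nonlinear in θ; symmetrization and contraction replace it by the linear process 2A(f_θ − f_θ₀), A
being its Lipschitz constant after rescaling. The exponential of its supremum is dominated by a sum
over vertices, where the prior weights make the exponential moments add up to at most 1. The
interpolated part is already linear in θ and needs only Bernstein's inequality at each vertex.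
Convexity of exp joins the two.

To conclude, let Δ be the difference of the penalized mixed risks at g₀ between the aggregate and
θ₀, and write Δ = 2Δ − Δ. Optimality, the deviation bound and the nuisance error (after Young's
inequality) bound 2Δ from above; quadratic growth bounds −Δ. The terms in d cancel, and those in
V(θ) and K(θ) are absorbed by the convexity gain and by the penalty. The doubling explains the
factor 2 on the nuisance term and the requirement 2τ ≤ β. -/

/-! ### Scalar inequalities for exp and cosh -/

theorem exp_sub_one_sub_id_le {u : ℝ} (hu : 3 * |u| < 10) :
    Real.exp u - 1 - u ≤ 57 / 100 * u ^ 2 / (1 - 3 / 10 * |u|) := by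
  have h1 : HasSum (fun k : ℕ => u ^ (k + 2) / ((k + 2).factorial : ℝ)) (Real.exp u - 1 - u) := by
    have h := NormedSpace.expSeries_div_hasSum_exp u
    rw [Real.exp_eq_exp_ℝ]
    have h2 := (hasSum_nat_add_iff' 2).2 h
    have e : NormedSpace.exp u - 1 - u
        = NormedSpace.exp u - ∑ i ∈ Finset.range 2, u ^ i / (i.factorial : ℝ) := by
      simp [Finset.sum_range_succ, sub_sub]
    rw [e]
    exact h2
  have h2 : HasSum (fun k : ℕ => 57 / 100 * u ^ 2 * (3 / 10 * |u|) ^ k)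
      (57 / 100 * u ^ 2 * (1 - 3 / 10 * |u|)⁻¹) :=
    (hasSum_geometric_of_lt_one (by positivity) (by linarith)).mul_left _
  rw [div_eq_mul_inv]
  refine hasSum_le (fun k => ?_) h1 h2
  -- The ratio 1/(k+3) of successive terms is at most 3/10 only from k = 1 on; at k = 0 it is 1/3,
  -- and taking 57/100 instead of 1/2 absorbs this. These constants let both Bernstein terms carry
  -- the same factor 3/5 later, matching the sum ν C_b + μ b in the lower bound on β.
  have h3 : (1 : ℝ) / ((k + 2).factorial : ℝ) ≤ 57 / 100 * (3 / 10) ^ k := by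
    induction k with
    | zero => norm_num [Nat.factorial]
    | succ k ih =>
      rcases Nat.eq_zero_or_pos k with rfl | hk
      · norm_num [Nat.factorial]
      · rw [show k + 1 + 2 = (k + 2) + 1 by ring, Nat.factorial_succ, pow_succ]
        push_cast
        have hk' : (1 : ℝ) ≤ k := by exact_mod_cast hk
        have h4 : (1 : ℝ) / ((k : ℝ) + 2 + 1) ≤ 3 / 10 := by
          rw [div_le_div_iff₀ (by positivity) (by norm_num)]; linarith
        calc (1 : ℝ) / (((k : ℝ) + 2 + 1) * ((k + 2).factorial : ℝ))
            = 1 / ((k + 2).factorial : ℝ) * (1 / ((k : ℝ) + 2 + 1)) := by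
              rw [one_div_mul_one_div, mul_comm]
          _ ≤ 57 / 100 * (3 / 10) ^ k * (3 / 10) := by gcongr
          _ = _ := by ring
  calc u ^ (k + 2) / ((k + 2).factorial : ℝ)
      ≤ |u| ^ (k + 2) / ((k + 2).factorial : ℝ) := by
        rw [← abs_pow]; gcongr; exact le_abs_self _
    _ = |u| ^ (k + 2) * (1 / ((k + 2).factorial : ℝ)) := by ring
    _ ≤ |u| ^ (k + 2) * (57 / 100 * (3 / 10) ^ k) := by gcongr
    _ = 57 / 100 * u ^ 2 * (3 / 10 * |u|) ^ k := by
        rw [pow_add, mul_pow, sq_abs]; ring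

/-- Geometric domination of the power series: consecutive coefficients have ratio 1/((2k+3)(2k+4)) ≤
1/12. The range of x is the one provided by the bound 8√3 b C_b (1−ν) ≤ β. -/
theorem cosh_le_one_add {x : ℝ} (hx : x ^ 2 ≤ 25 / 12) :
    Real.cosh x ≤ 1 + 63 / 100 * x ^ 2 := by
  have h1 : HasSum (fun k : ℕ => x ^ (2 * (k + 1)) / ((2 * (k + 1)).factorial : ℝ))
      (Real.cosh x - 1) := by
    have h2 := (hasSum_nat_add_iff' 1).2 (Real.hasSum_cosh x)
    simpa using h2
  have h2 : HasSum (fun k : ℕ => x ^ 2 / 2 * (x ^ 2 / 12) ^ k)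
      (x ^ 2 / 2 * (1 - x ^ 2 / 12)⁻¹) :=
    (hasSum_geometric_of_lt_one (by positivity) (by linarith)).mul_left _
  have h3 : Real.cosh x - 1 ≤ x ^ 2 / 2 * (1 - x ^ 2 / 12)⁻¹ := by
    refine hasSum_le (fun k => ?_) h1 h2
    have h3 : (1 : ℝ) / ((2 * (k + 1)).factorial : ℝ) ≤ 1 / 2 * (1 / 12) ^ k := by
      induction k with
      | zero => norm_num [Nat.factorial]
      | succ k ih =>
        rw [show 2 * (k + 1 + 1) = (2 * (k + 1) + 1) + 1 by ring, Nat.factorial_succ,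
          Nat.factorial_succ, pow_succ]
        push_cast
        have h4 : (1 : ℝ) / ((2 * ((k : ℝ) + 1) + 1 + 1) * (2 * ((k : ℝ) + 1) + 1)) ≤ 1 / 12 := by
          have hk : (0 : ℝ) ≤ k := k.cast_nonneg
          apply one_div_le_one_div_of_le (by norm_num); nlinarith
        calc (1 : ℝ) / ((2 * ((k : ℝ) + 1) + 1 + 1) * ((2 * ((k : ℝ) + 1) + 1) *
                ((2 * (k + 1)).factorial : ℝ)))
            = 1 / ((2 * (k + 1)).factorial : ℝ) *
                (1 / ((2 * ((k : ℝ) + 1) + 1 + 1) * (2 * ((k : ℝ) + 1) + 1))) := by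
              rw [one_div_mul_one_div]; congr 1; ring
          _ ≤ 1 / 2 * (1 / 12) ^ k * (1 / 12) := by gcongr
          _ = _ := by ring
    calc x ^ (2 * (k + 1)) / ((2 * (k + 1)).factorial : ℝ)
        = (x ^ 2) ^ (k + 1) * (1 / ((2 * (k + 1)).factorial : ℝ)) := by rw [← pow_mul]; ring
      _ ≤ (x ^ 2) ^ (k + 1) * (1 / 2 * (1 / 12) ^ k) := by gcongr
      _ = x ^ 2 / 2 * (x ^ 2 / 12) ^ k := by rw [div_eq_mul_inv (x ^ 2) 12, mul_pow]; ring
  have h4 : (1 - x ^ 2 / 12)⁻¹ ≤ 63 / 50 := by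
    rw [inv_le_comm₀ (by linarith) (by norm_num)]; linarith
  nlinarith [mul_le_mul_of_nonneg_left h4 (by positivity : 0 ≤ x ^ 2 / 2)]

/-- The increment of exp from r to q starts lower and is no longer than the one from p to s. -/
theorem exp_add_exp_le_of_add_le {p q r s : ℝ} (hp : r ≤ p) (hq : r ≤ q) (h : p + q ≤ r + s) :
    Real.exp p + Real.exp q ≤ Real.exp r + Real.exp s := by
  have e1 : Real.exp q - Real.exp r = Real.exp r * (Real.exp (q - r) - 1) := by
    rw [mul_sub, ← Real.exp_add]; simp
  have e2 : Real.exp s - Real.exp p = Real.exp p * (Real.exp (s - p) - 1) := by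
    rw [mul_sub, ← Real.exp_add]; simp
  have a1 : Real.exp (q - r) ≤ Real.exp (s - p) := Real.exp_le_exp.2 (by linarith)
  have a2 : Real.exp r ≤ Real.exp p := Real.exp_le_exp.2 hp
  have a3 : 1 ≤ Real.exp (q - r) := Real.one_le_exp (by linarith)
  have := mul_le_mul a2 (sub_le_sub_right a1 1) (by linarith) (Real.exp_pos p).le
  linarith

/-! ### Symmetrization and contraction for exponentials of suprema -/

/-- A convex functional on `ι → ℝ` with the comparison property behind the contraction principle for
one Rademacher sign. -/
structure IsSignContractive {ι : Type*} (Φ : (ι → ℝ) → ℝ) : Prop where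
  convexOn : ConvexOn ℝ Set.univ Φ
  add_le : ∀ a h y : ι → ℝ, (∀ i, |h i| ≤ |y i|) → (∀ i k, |h i - h k| ≤ |y i - y k|) →
    Φ (a + h) + Φ (a - h) ≤ Φ (a + y) + Φ (a - y)

/-- The functional `a ↦ max_i exp (a i)`. -/
noncomputable def expSup {ι : Type*} (a : ι → ℝ) : ℝ := ⨆ i, Real.exp (a i)

/-- The value of `expSup` at `a` perturbed by `n` independent copies of `± y`, in expectation. -/
noncomputable def symIter {𝒵 ι : Type*} [MeasurableSpace 𝒵] (P : Measure 𝒵) (y : 𝒵 → ι → ℝ) :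
    ℕ → (ι → ℝ) → ℝ
  | 0 => expSup
  | n + 1 => fun a => ∫ z, (symIter P y n (a + y z) + symIter P y n (a - y z)) / 2 ∂P

theorem expSup_nonneg {ι : Type*} (a : ι → ℝ) : 0 ≤ expSup a :=
  Real.iSup_nonneg fun _ => (Real.exp_pos _).le

section

variable {𝒵 ι : Type*} [MeasurableSpace 𝒵] [Fintype ι] {P : Measure 𝒵}

theorem IsSignContractive.continuous {Φ : (ι → ℝ) → ℝ} (hΦ : IsSignContractive Φ) :
    Continuous Φ := hΦ.convexOn.locallyLipschitz.continuous

theorem integrable_comp_of_continuous [IsFiniteMeasure P] {Φ : (ι → ℝ) → ℝ} (hΦ : Continuous Φ)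
    {g : 𝒵 → ι → ℝ} (hg : AEStronglyMeasurable g P) {B : ℝ} (hB : ∀ᵐ z ∂P, ‖g z‖ ≤ B) :
    Integrable (fun z => Φ (g z)) P := by
  obtain ⟨C, hC⟩ := (isCompact_closedBall (0 : ι → ℝ) B).exists_bound_of_continuousOn
    hΦ.continuousOn
  refine Integrable.of_bound (hΦ.comp_aestronglyMeasurable hg) C ?_
  filter_upwards [hB] with z hz
  exact hC _ (by simpa using hz)

theorem le_expSup (a : ι → ℝ) (i : ι) : Real.exp (a i) ≤ expSup a :=
  le_ciSup (Set.finite_range fun i => Real.exp (a i)).bddAbove i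

theorem exists_expSup_eq [Nonempty ι] (a : ι → ℝ) : ∃ i, expSup a = Real.exp (a i) :=
  let ⟨i, hi⟩ := exists_eq_ciSup_of_finite (f := fun i => Real.exp (a i)); ⟨i, hi.symm⟩

/-- Let i and k be maximizers for a + h and a − h. If y i and y k have opposite signs, the two
exponentials are dominated separately. If they have the same sign, the pair is spread apart by
`exp_add_exp_le_of_add_le`; the order condition linking the two indices comes from the maximality of
i or of k. -/
theorem isSignContractive_expSup [Nonempty ι] : IsSignContractive (expSup : (ι → ℝ) → ℝ) where
  convexOn := by
    refine ⟨convex_univ, fun a _ b _ s t hs ht hst => ?_⟩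
    obtain ⟨i, hi⟩ := exists_expSup_eq (s • a + t • b)
    rw [hi]
    have := convexOn_exp.2 (Set.mem_univ (a i)) (Set.mem_univ (b i)) hs ht hst
    refine this.trans ?_
    simp only [smul_eq_mul]
    exact add_le_add (mul_le_mul_of_nonneg_left (le_expSup a i) hs)
      (mul_le_mul_of_nonneg_left (le_expSup b i) ht)
  add_le a h y h1 h2 := by
    obtain ⟨i, hi⟩ := exists_expSup_eq (a + h)
    obtain ⟨k, hk⟩ := exists_expSup_eq (a - h)
    have m1 := le_expSup (a + h) k
    have m2 := le_expSup (a - h) i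
    rw [hi, Real.exp_le_exp] at m1
    rw [hk, Real.exp_le_exp] at m2
    have p1 := le_expSup (a + y) i
    have p2 := le_expSup (a + y) k
    have p3 := le_expSup (a - y) i
    have p4 := le_expSup (a - y) k
    rw [hi, hk]
    simp only [Pi.add_apply, Pi.sub_apply] at *
    have hhi := h1 i
    have hhk := h1 k
    have hik := h2 i k
    rw [abs_le] at hik
    rcases le_total 0 (y i) with yi | yi <;> rcases le_total 0 (y k) with yk | yk
    · rw [abs_of_nonneg yi, abs_le] at hhi
      rw [abs_of_nonneg yk, abs_le] at hhk
      rcases le_total (y k) (y i) with hle | hle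
      · rw [abs_of_nonneg (sub_nonneg.2 hle)] at hik
        have := exp_add_exp_le_of_add_le (p := a i + h i) (q := a k - h k) (r := a k - y k)
          (s := a i + y i) (by linarith) (by linarith) (by linarith)
        linarith
      · rw [abs_of_nonpos (sub_nonpos.2 hle)] at hik
        have := exp_add_exp_le_of_add_le (p := a i + h i) (q := a k - h k) (r := a i - y i)
          (s := a k + y k) (by linarith) (by linarith) (by linarith)
        linarith
    · rw [abs_of_nonneg yi, abs_le] at hhi
      rw [abs_of_nonpos yk, abs_le] at hhk
      have q1 : Real.exp (a i + h i) ≤ Real.exp (a i + y i) := Real.exp_le_exp.2 (by linarith)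
      have q2 : Real.exp (a k - h k) ≤ Real.exp (a k - y k) := Real.exp_le_exp.2 (by linarith)
      linarith
    · rw [abs_of_nonpos yi, abs_le] at hhi
      rw [abs_of_nonneg yk, abs_le] at hhk
      have q1 : Real.exp (a i + h i) ≤ Real.exp (a i - y i) := Real.exp_le_exp.2 (by linarith)
      have q2 : Real.exp (a k - h k) ≤ Real.exp (a k + y k) := Real.exp_le_exp.2 (by linarith)
      linarith
    · rw [abs_of_nonpos yi, abs_le] at hhi
      rw [abs_of_nonpos yk, abs_le] at hhk
      rcases le_total (y k) (y i) with hle | hle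
      · rw [abs_of_nonneg (sub_nonneg.2 hle)] at hik
        have := exp_add_exp_le_of_add_le (p := a i + h i) (q := a k - h k) (r := a i + y i)
          (s := a k - y k) (by linarith) (by linarith) (by linarith)
        linarith
      · rw [abs_of_nonpos (sub_nonpos.2 hle)] at hik
        have := exp_add_exp_le_of_add_le (p := a i + h i) (q := a k - h k) (r := a k + y k)
          (s := a i - y i) (by linarith) (by linarith) (by linarith)
        linarith

/-- Translations by ± y z preserve both properties, and so does averaging. Hence a coordinate can be
contracted while the others are already symmetrized. -/
theorem isSignContractive_symIter [Nonempty ι] [IsProbabilityMeasure P] {y : 𝒵 → ι → ℝ}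
    (hy : AEStronglyMeasurable y P) {B : ℝ} (hB : ∀ᵐ z ∂P, ‖y z‖ ≤ B) (n : ℕ) :
    IsSignContractive (symIter P y n) := by
  induction n with
  | zero => exact isSignContractive_expSup
  | succ n ih =>
    have hint : ∀ a, Integrable
        (fun z => (symIter P y n (a + y z) + symIter P y n (a - y z)) / 2) P := fun a =>
      ((integrable_comp_of_continuous (Φ := fun v => symIter P y n (a + v))
        (ih.continuous.comp (by fun_prop)) hy hB).add
      (integrable_comp_of_continuous (Φ := fun v => symIter P y n (a - v))
        (ih.continuous.comp (by fun_prop)) hy hB)).div_const 2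
    refine ⟨⟨convex_univ, fun a _ b _ s t hs ht hst => ?_⟩, fun a h v h1 h2 => ?_⟩
    · simp only [symIter, smul_eq_mul]
      rw [← integral_const_mul, ← integral_const_mul, ← integral_add ((hint a).const_mul s)
        ((hint b).const_mul t)]
      refine integral_mono (hint _) (((hint a).const_mul s).add ((hint b).const_mul t)) fun z => ?_
      have c1 := ih.convexOn.2 (Set.mem_univ (a + y z)) (Set.mem_univ (b + y z)) hs ht hst
      have c2 := ih.convexOn.2 (Set.mem_univ (a - y z)) (Set.mem_univ (b - y z)) hs ht hst
      have e1 : s • (a + y z) + t • (b + y z) = s • a + t • b + y z := by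
        rw [smul_add, smul_add, add_add_add_comm, ← add_smul, hst, one_smul]
      have e2 : s • (a - y z) + t • (b - y z) = s • a + t • b - y z := by
        rw [smul_sub, smul_sub, sub_add_sub_comm, ← add_smul, hst, one_smul]
      rw [e1] at c1
      rw [e2] at c2
      simp only [smul_eq_mul] at c1 c2 ⊢
      linarith
    · simp only [symIter]
      rw [← integral_add (hint _) (hint _), ← integral_add (hint _) (hint _)]
      refine integral_mono ((hint _).add (hint _)) ((hint _).add (hint _)) fun z => ?_
      have c1 := ih.add_le (a + y z) h v h1 h2
      have c2 := ih.add_le (a - y z) h v h1 h2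
      have e : ∀ w : ι → ℝ, a + w + y z = a + y z + w ∧ a + w - y z = a - y z + w ∧
          a - w + y z = a + y z - w ∧ a - w - y z = a - y z - w := fun w =>
        ⟨by abel, by abel, by abel, by abel⟩
      simp only [(e h).1, (e h).2.1, (e h).2.2.1, (e h).2.2.2, (e v).1, (e v).2.1, (e v).2.2.1,
        (e v).2.2.2]
      linarith

/-- Symmetrization and contraction in one coordinate. -/
theorem IsSignContractive.integral_sub_le [IsProbabilityMeasure P] {Φ : (ι → ℝ) → ℝ}
    (hΦ : IsSignContractive Φ) {h y : 𝒵 → ι → ℝ}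
    (hh : AEStronglyMeasurable h P) (hy : AEStronglyMeasurable y P) {B : ℝ}
    (hhB : ∀ᵐ z ∂P, ‖h z‖ ≤ B) (hyB : ∀ᵐ z ∂P, ‖y z‖ ≤ B)
    (h1 : ∀ᵐ z ∂P, ∀ i, 2 * |h z i| ≤ |y z i|)
    (h2 : ∀ᵐ z ∂P, ∀ i k, 2 * |h z i - h z k| ≤ |y z i - y z k|) (a : ι → ℝ) :
    ∫ z, Φ (a + (∫ w, h w ∂P) - h z) ∂P ≤ ∫ z, (Φ (a + y z) + Φ (a - y z)) / 2 ∂P := by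
  have hc := hΦ.continuous
  set m := ∫ w, h w ∂P
  have hhi : Integrable h P := Integrable.of_bound hh B hhB
  have i1 : Integrable (fun z => Φ (a + m - h z)) P :=
    integrable_comp_of_continuous (Φ := fun v => Φ (a + m - v)) (hc.comp (by fun_prop)) hh hhB
  have i2 : Integrable (fun z => Φ (a + (2 : ℝ) • h z)) P :=
    integrable_comp_of_continuous (Φ := fun v => Φ (a + (2 : ℝ) • v)) (hc.comp (by fun_prop)) hh hhB
  have i3 : Integrable (fun z => Φ (a - (2 : ℝ) • h z)) P :=
    integrable_comp_of_continuous (Φ := fun v => Φ (a - (2 : ℝ) • v)) (hc.comp (by fun_prop)) hh hhB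
  have i4 : Integrable (fun z => Φ (a + y z)) P :=
    integrable_comp_of_continuous (Φ := fun v => Φ (a + v)) (hc.comp (by fun_prop)) hy hyB
  have i5 : Integrable (fun z => Φ (a - y z)) P :=
    integrable_comp_of_continuous (Φ := fun v => Φ (a - v)) (hc.comp (by fun_prop)) hy hyB
  -- No independent copy is needed: a + m − h z is the midpoint of a + 2m and a − 2 h z, and
  -- Jensen's inequality moves the mean out of the first. The resulting pair a ± 2h is contracted to
  -- a ± y.
  have jensen : Φ (a + (2 : ℝ) • m) ≤ ∫ z, Φ (a + (2 : ℝ) • h z) ∂P := by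
    have hconv : ConvexOn ℝ Set.univ (fun v => Φ (a + (2 : ℝ) • v)) := by
      refine ⟨convex_univ, fun u _ v _ s t hs ht hst => ?_⟩
      have := hΦ.convexOn.2 (Set.mem_univ (a + (2 : ℝ) • u)) (Set.mem_univ (a + (2 : ℝ) • v))
        hs ht hst
      convert this using 2
      rw [smul_add s, smul_add t, add_add_add_comm, ← add_smul, hst, one_smul, smul_add,
        smul_comm s, smul_comm t]
    exact hconv.map_integral_le (hc.comp (by fun_prop)).continuousOn isClosed_univ
      (by simp) hhi i2
  calc ∫ z, Φ (a + m - h z) ∂P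
      ≤ ∫ z, (Φ (a + (2 : ℝ) • m) / 2 + Φ (a - (2 : ℝ) • h z) / 2) ∂P := by
        refine integral_mono i1 ((integrable_const _).add (i3.div_const 2)) fun z => ?_
        have := hΦ.convexOn.2 (Set.mem_univ (a + (2 : ℝ) • m)) (Set.mem_univ (a - (2 : ℝ) • h z))
          (by norm_num : (0 : ℝ) ≤ 1 / 2) (by norm_num : (0 : ℝ) ≤ 1 / 2) (by norm_num)
        have e : (1 / 2 : ℝ) • (a + (2 : ℝ) • m) + (1 / 2 : ℝ) • (a - (2 : ℝ) • h z)
            = a + m - h z := by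
          ext i; simp; ring
        rw [e] at this
        simp only [smul_eq_mul] at this ⊢
        linarith
    _ = Φ (a + (2 : ℝ) • m) / 2 + ∫ z, Φ (a - (2 : ℝ) • h z) / 2 ∂P := by
        rw [integral_add (integrable_const _) (i3.div_const 2)]; simp
    _ ≤ (∫ z, Φ (a + (2 : ℝ) • h z) ∂P) / 2 + ∫ z, Φ (a - (2 : ℝ) • h z) / 2 ∂P := by gcongr
    _ = ∫ z, (Φ (a + (2 : ℝ) • h z) + Φ (a - (2 : ℝ) • h z)) / 2 ∂P := by
        rw [← integral_div, ← integral_add (i2.div_const 2) (i3.div_const 2)]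
        simp only [add_div]
    _ ≤ ∫ z, (Φ (a + y z) + Φ (a - y z)) / 2 ∂P := by
        refine integral_mono_ae ((i2.add i3).div_const 2) ((i4.add i5).div_const 2) ?_
        filter_upwards [h1, h2] with z h1 h2
        have := hΦ.add_le a ((2 : ℝ) • h z) (y z) (fun i => by simpa [abs_mul] using h1 i)
          (fun i k => by
            rw [Pi.smul_apply, Pi.smul_apply, ← smul_sub, smul_eq_mul, abs_mul]
            simpa using h2 i k)
        linarith

/-- Symmetrization and contraction for the exponential of a supremum. -/
theorem integral_expSup_le_symIter [Nonempty ι] [IsProbabilityMeasure P] {h y : 𝒵 → ι → ℝ}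
    (hh : AEStronglyMeasurable h P) (hy : AEStronglyMeasurable y P) {B : ℝ}
    (hhB : ∀ᵐ z ∂P, ‖h z‖ ≤ B) (hyB : ∀ᵐ z ∂P, ‖y z‖ ≤ B)
    (h1 : ∀ᵐ z ∂P, ∀ i, 2 * |h z i| ≤ |y z i|)
    (h2 : ∀ᵐ z ∂P, ∀ i k, 2 * |h z i - h z k| ≤ |y z i - y z k|) (n : ℕ) (a : ι → ℝ) :
    ∫ z, expSup (a + ∑ k, ((∫ w, h w ∂P) - h (z k))) ∂(Measure.pi fun _ : Fin n => P)
      ≤ symIter P y n a := by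
  induction n generalizing a with
  | zero => simp [symIter]
  | succ n ih =>
    set m := ∫ w, h w ∂P with hm
    have key := (isSignContractive_symIter hy hyB n).integral_sub_le hh hy hhB hyB h1 h2 a
    refine le_trans ?_ key
    -- Coordinate 0 is split off. With it fixed, the induction hypothesis treats the others at the
    -- shifted point a + m − h z; `key` then symmetrizes coordinate 0 for the functional `symIter P
    -- y n`.
    have mp := measurePreserving_piFinSuccAbove (fun _ : Fin (n + 1) => P) 0
    rw [← mp.symm.integral_comp (MeasurableEquiv.measurableEmbedding _)]
    have hpi : ∀ k : Fin n, AEStronglyMeasurable (fun z : Fin n → 𝒵 => h (z k))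
        (Measure.pi fun _ : Fin n => P) := fun k =>
      hh.comp_quasiMeasurePreserving (Measure.quasiMeasurePreserving_eval _ k)
    have hpiB : ∀ k : Fin n, ∀ᵐ z ∂(Measure.pi fun _ : Fin n => P), ‖h (z k)‖ ≤ B := fun k =>
      (Measure.quasiMeasurePreserving_eval (fun _ : Fin n => P) k).ae hhB
    have hsum : AEStronglyMeasurable (fun z : Fin n → 𝒵 => ∑ k, (m - h (z k)))
        (Measure.pi fun _ : Fin n => P) := by
      refine Finset.aestronglyMeasurable_fun_sum _ fun k _ => ?_
      exact aestronglyMeasurable_const.sub (hpi k)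
    have hsumB : ∀ᵐ z ∂(Measure.pi fun _ : Fin n => P), ‖∑ k, (m - h (z k))‖ ≤ n * (‖m‖ + B) := by
      filter_upwards [ae_all_iff.2 hpiB] with z hz
      refine (norm_sum_le _ _).trans ?_
      refine (Finset.sum_le_card_nsmul _ _ (‖m‖ + B) fun k _ => ?_).trans (by simp [mul_add])
      exact (norm_sub_le _ _).trans (by linarith [hz k])
    have hprod : Integrable (fun p : 𝒵 × (Fin n → 𝒵) =>
        expSup (a + (m - h p.1) + ∑ k, (m - h (p.2 k))))
        (P.prod (Measure.pi fun _ : Fin n => P)) := by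
      have hg : AEStronglyMeasurable (fun p : 𝒵 × (Fin n → 𝒵) =>
          (m - h p.1) + ∑ k, (m - h (p.2 k))) (P.prod (Measure.pi fun _ : Fin n => P)) :=
        (aestronglyMeasurable_const.sub hh.comp_fst).add hsum.comp_snd
      have := integrable_comp_of_continuous (Φ := fun v => expSup (a + v))
        ((isSignContractive_expSup (ι := ι)).continuous.comp (by fun_prop)) hg
        (B := (‖m‖ + B) + n * (‖m‖ + B)) (by
          filter_upwards [Measure.quasiMeasurePreserving_fst.ae hhB,
            Measure.quasiMeasurePreserving_snd.ae hsumB] with p p1 p2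
          refine (norm_add_le _ _).trans (add_le_add ?_ p2)
          exact (norm_sub_le _ _).trans (by linarith))
      simpa only [add_assoc] using this
    have e : ∀ p : 𝒵 × (Fin n → 𝒵),
        expSup (a + ∑ k, (m - h ((MeasurableEquiv.piFinSuccAbove (fun _ : Fin (n + 1) => 𝒵) 0).symm
          p k))) = expSup (a + (m - h p.1) + ∑ k, (m - h (p.2 k))) := fun p => by
      rw [Fin.sum_univ_succ, ← add_assoc]
      rfl
    simp only [e]
    rw [integral_prod _ hprod]
    refine integral_mono hprod.integral_prod_left ?_ fun z => ?_
    · have := (isSignContractive_symIter hy hyB n).continuous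
      exact integrable_comp_of_continuous (Φ := fun v => symIter P y n (a + m - v))
        (this.comp (by fun_prop)) hh hhB
    · have := ih (a + (m - h z))
      simpa only [add_sub_assoc] using this

/-- When `a` and `y` are convex combinations of `M` sequences, the supremum in `symIter` may be taken
over these. -/
theorem symIter_le_sum [Nonempty ι] [IsProbabilityMeasure P] {M : ℕ} {y : 𝒵 → ι → ℝ}
    {B : ℝ} (θ : ι → Fin M → ℝ) (hθ : ∀ i, θ i ∈ stdSimplex ℝ (Fin M)) {v : Fin M → 𝒵 → ℝ}
    (hv : ∀ j, AEStronglyMeasurable (v j) P) (hvB : ∀ j, ∀ᵐ z ∂P, |v j z| ≤ B)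
    (hy : ∀ z i, y z i = ∑ j, θ i j * v j z) (n : ℕ) (c : Fin M → ℝ) :
    symIter P y n (fun i => ∑ j, θ i j * c j)
      ≤ ∑ j, Real.exp (c j) * (∫ z, Real.cosh (v j z) ∂P) ^ n := by
  have hym : AEStronglyMeasurable y P := by
    refine (aemeasurable_pi_iff.2 fun i => ?_).aestronglyMeasurable
    simp only [hy]
    exact Finset.aemeasurable_fun_sum _ fun j _ => (hv j).aemeasurable.const_mul _
  have hyB : ∀ᵐ z ∂P, ‖y z‖ ≤ |B| := by
    filter_upwards [ae_all_iff.2 hvB] with z hz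
    refine (pi_norm_le_iff_of_nonneg (abs_nonneg B)).2 fun i => ?_
    rw [hy, Real.norm_eq_abs]
    refine (Finset.abs_sum_le_sum_abs _ _).trans ?_
    calc ∑ j, |θ i j * v j z| ≤ ∑ j, θ i j * |B| := by
          refine Finset.sum_le_sum fun j _ => ?_
          rw [abs_mul, abs_of_nonneg ((hθ i).1 j)]
          exact mul_le_mul_of_nonneg_left ((hz j).trans (le_abs_self B)) ((hθ i).1 j)
      _ = |B| := by rw [← Finset.sum_mul, (hθ i).2, one_mul]
  induction n generalizing c with
  | zero =>
    simp only [symIter, pow_zero, mul_one]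
    obtain ⟨i, hi⟩ := exists_expSup_eq (fun i => ∑ j, θ i j * c j)
    rw [hi]
    -- Jensen bounds the maximum by a convex combination of the exp (c j); as weights are at most 1,
    -- the full sum is a bound free of i.
    have := convexOn_exp.map_sum_le (t := Finset.univ) (w := θ i) (p := c)
      (fun j _ => (hθ i).1 j) (hθ i).2 (fun _ _ => Set.mem_univ _)
    simp only [smul_eq_mul] at this
    refine this.trans (Finset.sum_le_sum fun j _ => ?_)
    have hj : θ i j ≤ 1 := by
      rw [← (hθ i).2]; exact Finset.single_le_sum (fun k _ => (hθ i).1 k) (Finset.mem_univ j)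
    exact mul_le_of_le_one_left (Real.exp_pos _).le hj
  | succ n ih =>
    have hc := (isSignContractive_symIter hym hyB n).continuous
    simp only [symIter]
    have hcosh : ∀ j, Integrable (fun z => Real.cosh (v j z)) P := fun j => by
      refine Integrable.of_bound (Real.continuous_cosh.comp_aestronglyMeasurable (hv j))
        (Real.cosh B) ?_
      filter_upwards [hvB j] with z hz
      rw [Real.norm_eq_abs, abs_of_pos (Real.cosh_pos _), Real.cosh_le_cosh]
      exact hz.trans (le_abs_self B)
    calc _ ≤ ∫ z, ∑ j, Real.exp (c j) * (∫ z, Real.cosh (v j z) ∂P) ^ n * Real.cosh (v j z) ∂P := by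
          refine integral_mono ?_ (integrable_finsetSum _ fun j _ => (hcosh j).const_mul _)
            fun z => ?_
          · exact ((integrable_comp_of_continuous
              (Φ := fun u => symIter P y n ((fun i => ∑ j, θ i j * c j) + u))
              (hc.comp (by fun_prop)) hym hyB).add (integrable_comp_of_continuous
              (Φ := fun u => symIter P y n ((fun i => ∑ j, θ i j * c j) - u))
              (hc.comp (by fun_prop)) hym hyB)).div_const 2
          -- Adding ± y z only shifts c j by ± v j z, so the induction hypothesis applies to both
          -- signs, and their mean produces cosh.
          · have e1 : (fun i => ∑ j, θ i j * c j) + y z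
                = fun i => ∑ j, θ i j * (c j + v j z) := by
              ext i; simp [hy, mul_add, Finset.sum_add_distrib]
            have e2 : (fun i => ∑ j, θ i j * c j) - y z
                = fun i => ∑ j, θ i j * (c j - v j z) := by
              ext i; simp [hy, mul_sub, Finset.sum_sub_distrib]
            have i1 := ih (fun j => c j + v j z)
            have i2 := ih (fun j => c j - v j z)
            simp only
            rw [e1, e2]
            refine (div_le_div_of_nonneg_right (add_le_add i1 i2) (by norm_num)).trans (le_of_eq ?_)
            rw [← Finset.sum_add_distrib, Finset.sum_div]
            refine Finset.sum_congr rfl fun j _ => ?_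
            rw [Real.cosh_eq, Real.exp_add, sub_eq_add_neg, Real.exp_add]
            ring
      _ = _ := by
          rw [integral_finsetSum _ fun j _ => (hcosh j).const_mul _]
          refine Finset.sum_congr rfl fun j _ => ?_
          rw [integral_const_mul, pow_succ, mul_assoc]

end

/-! ### Exponential moments of empirical deviations -/

section

variable {𝒵 : Type*} [MeasurableSpace 𝒵] {P : Measure 𝒵} [IsProbabilityMeasure P] {M n : ℕ}

/-- The deviation `∑ k, (P h - h (z k))` of a sample from its expectation. -/
noncomputable def empDev (P : Measure 𝒵) (h : 𝒵 → ℝ) (z : Fin n → 𝒵) : ℝ :=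
  ∑ k, ((∫ w, h w ∂P) - h (z k))

omit [IsProbabilityMeasure P] in
theorem empDev_add {h h' : 𝒵 → ℝ} (hh : Integrable h P) (hh' : Integrable h' P)
    (z : Fin n → 𝒵) :
    empDev P (fun w => h w + h' w) z = empDev P h z + empDev P h' z := by
  simp only [empDev, integral_add hh hh', ← Finset.sum_add_distrib]
  exact Finset.sum_congr rfl fun k _ => by ring

omit [IsProbabilityMeasure P] in
theorem empDev_const_mul (c : ℝ) (h : 𝒵 → ℝ) (z : Fin n → 𝒵) :
    empDev P (fun w => c * h w) z = c * empDev P h z := by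
  simp only [empDev, integral_const_mul, Finset.mul_sum, mul_sub]

omit [IsProbabilityMeasure P] in
theorem empDev_sum {κ : Type*} (s : Finset κ) {h : κ → 𝒵 → ℝ} (hh : ∀ j ∈ s, Integrable (h j) P)
    (z : Fin n → 𝒵) :
    empDev P (fun w => ∑ j ∈ s, h j w) z = ∑ j ∈ s, empDev P (h j) z := by
  simp only [empDev, integral_finsetSum s hh, ← Finset.sum_sub_distrib]
  rw [Finset.sum_comm]

theorem abs_empDev_le {h : 𝒵 → ℝ} {c : ℝ} (hc : ∀ᵐ w ∂P, |h w| ≤ c) {z : Fin n → 𝒵}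
    (hz : ∀ k, |h (z k)| ≤ c) : |empDev P h z| ≤ n * (2 * c) := by
  have h1 : |∫ w, h w ∂P| ≤ c := by
    have := norm_integral_le_of_norm_le_const (μ := P) (f := h) (C := c) (by simpa using hc)
    simpa using this
  refine (Finset.abs_sum_le_sum_abs _ _).trans ?_
  refine (Finset.sum_le_card_nsmul _ _ (2 * c) fun k _ => ?_).trans (by simp)
  exact (abs_sub _ _).trans (by linarith [hz k])

theorem aestronglyMeasurable_empDev {h : 𝒵 → ℝ} (hh : AEStronglyMeasurable h P) :
    AEStronglyMeasurable (empDev P h) (Measure.pi fun _ : Fin n => P) := by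
  refine Finset.aestronglyMeasurable_fun_sum _ fun k _ => ?_
  exact aestronglyMeasurable_const.sub
    (hh.comp_quasiMeasurePreserving (Measure.quasiMeasurePreserving_eval _ k))

theorem ae_pi_forall {p : 𝒵 → Prop} (hp : ∀ᵐ w ∂P, p w) :
    ∀ᵐ z ∂(Measure.pi fun _ : Fin n => P), ∀ k, p (z k) :=
  ae_all_iff.2 fun k => (Measure.quasiMeasurePreserving_eval (fun _ : Fin n => P) k).ae hp

theorem ae_abs_empDev_le {h : 𝒵 → ℝ} {c : ℝ} (hc : ∀ᵐ w ∂P, |h w| ≤ c) :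
    ∀ᵐ z ∂(Measure.pi fun _ : Fin n => P), |empDev P h z| ≤ n * (2 * c) := by
  filter_upwards [ae_pi_forall hc] with z hz using abs_empDev_le hc hz

theorem abs_sum_mul_le {θ : Fin M → ℝ} (hθ : θ ∈ stdSimplex ℝ (Fin M)) {x : Fin M → ℝ} {b : ℝ}
    (hx : ∀ j, |x j| ≤ b) : |∑ j, θ j * x j| ≤ b := by
  refine (Finset.abs_sum_le_sum_abs _ _).trans ?_
  calc ∑ j, |θ j * x j| ≤ ∑ j, θ j * b := by
        refine Finset.sum_le_sum fun j _ => ?_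
        rw [abs_mul, abs_of_nonneg (hθ.1 j)]
        exact mul_le_mul_of_nonneg_left (hx j) (hθ.1 j)
    _ = b := by rw [← Finset.sum_mul, hθ.2, one_mul]

/-- Exponential moment bound for the nonlinear part of the deviation. -/
theorem integral_expSup_empDev_le {ι : Type*} [Fintype ι] [Nonempty ι]
    {F : Fin M → 𝒵 → ℝ} (hF : ∀ j, AEStronglyMeasurable (F j) P) {b : ℝ}
    (hFb : ∀ᵐ z ∂P, ∀ j, |F j z| ≤ b)
    {θ : ι → Fin M → ℝ} (hθ : ∀ i, θ i ∈ stdSimplex ℝ (Fin M))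
    {θ₀ : Fin M → ℝ} (hθ₀ : θ₀ ∈ stdSimplex ℝ (Fin M))
    {H : ι → 𝒵 → ℝ} (hH : ∀ i, AEStronglyMeasurable (H i) P) {A q : ℝ} (hA : 0 ≤ A)
    (h1 : ∀ᵐ z ∂P, ∀ i, |H i z| ≤ A * |∑ j, θ i j * F j z - ∑ j, θ₀ j * F j z|)
    (h2 : ∀ᵐ z ∂P, ∀ i k, |H i z - H k z| ≤ A * |∑ j, θ i j * F j z - ∑ j, θ k j * F j z|)
    (hAb : 16 * A ^ 2 * b ^ 2 ≤ 25 / 12) (hq : 252 / 100 * A ^ 2 ≤ q)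
    {π : Fin M → ℝ} (hπ : ∀ j, 0 < π j) (hπ1 : ∑ j, π j = 1) :
    ∫ z, expSup (fun i => empDev P (H i) z - ∑ j, θ i j *
        (n * q * ∫ w, (F j w - ∑ k, θ₀ k * F k w) ^ 2 ∂P + Real.log (1 / π j)))
      ∂(Measure.pi fun _ : Fin n => P) ≤ 1 := by
  set D : Fin M → ℝ := fun j => ∫ w, (F j w - ∑ k, θ₀ k * F k w) ^ 2 ∂P with hD
  -- The θ i-combination of the v j is 2A(f_θ − f_θ₀): linear in θ, and twice the Lipschitz majorant
  -- of H, as the contraction step demands.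
  set v : Fin M → 𝒵 → ℝ := fun j z => 2 * A * (F j z - ∑ k, θ₀ k * F k z) with hv
  set y : 𝒵 → ι → ℝ := fun z i => ∑ j, θ i j * v j z with hy
  set h : 𝒵 → ι → ℝ := fun z i => H i z with hh
  have hb : ∀ᵐ z ∂P, ∀ j, |F j z - ∑ k, θ₀ k * F k z| ≤ 2 * b := by
    filter_upwards [hFb] with z hz j
    exact (abs_sub _ _).trans (by linarith [hz j, abs_sum_mul_le hθ₀ hz])
  have hF0 : ∀ j, AEStronglyMeasurable (fun z => F j z - ∑ k, θ₀ k * F k z) P := fun j =>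
    (hF j).sub (Finset.aestronglyMeasurable_fun_sum _ fun k _ => (hF k).const_mul _)
  have hvm : ∀ j, AEStronglyMeasurable (v j) P := fun j => (hF0 j).const_mul _
  have hvb : ∀ j, ∀ᵐ z ∂P, |v j z| ≤ 4 * A * b := fun j => by
    filter_upwards [hb] with z hz
    rw [hv, abs_mul, abs_of_nonneg (by positivity : 0 ≤ 2 * A)]
    nlinarith [mul_le_mul_of_nonneg_left (hz j) hA]
  have hyF : ∀ z i, y z i = 2 * A * (∑ j, θ i j * F j z - ∑ j, θ₀ j * F j z) := fun z i => by
    have : ∑ j, θ i j * v j z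
        = 2 * A * (∑ j, θ i j * F j z) - (∑ j, θ i j) * (2 * A * ∑ k, θ₀ k * F k z) := by
      rw [Finset.sum_mul, Finset.mul_sum, ← Finset.sum_sub_distrib]
      exact Finset.sum_congr rfl fun j _ => by simp only [hv]; ring
    rw [hy]
    simp only
    rw [this, (hθ i).2]
    ring
  have hym : AEStronglyMeasurable y P := by
    refine (aemeasurable_pi_iff.2 fun i => ?_).aestronglyMeasurable
    exact Finset.aemeasurable_fun_sum _ fun j _ => (hvm j).aemeasurable.const_mul _
  have hhm : AEStronglyMeasurable h P :=
    (aemeasurable_pi_iff.2 fun i => (hH i).aemeasurable).aestronglyMeasurable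
  have hyb : ∀ᵐ z ∂P, ‖y z‖ ≤ |4 * A * b| := by
    filter_upwards [ae_all_iff.2 hvb] with z hz
    refine (pi_norm_le_iff_of_nonneg (abs_nonneg _)).2 fun i => ?_
    exact abs_sum_mul_le (hθ i) fun j => (hz j).trans (le_abs_self _)
  have h1' : ∀ᵐ z ∂P, ∀ i, 2 * |h z i| ≤ |y z i| := by
    filter_upwards [h1] with z hz i
    rw [hyF, abs_mul, abs_of_nonneg (by positivity : 0 ≤ 2 * A)]
    linarith [hz i]
  have h2' : ∀ᵐ z ∂P, ∀ i k, 2 * |h z i - h z k| ≤ |y z i - y z k| := by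
    filter_upwards [h2] with z hz i k
    rw [hyF, hyF, ← mul_sub, sub_sub_sub_cancel_right, abs_mul,
      abs_of_nonneg (by positivity : 0 ≤ 2 * A)]
    linarith [hz i k]
  have hhb : ∀ᵐ z ∂P, ‖h z‖ ≤ |4 * A * b| := by
    filter_upwards [hyb, h1'] with z hz hz1
    refine (pi_norm_le_iff_of_nonneg (abs_nonneg _)).2 fun i => ?_
    have := (norm_le_pi_norm (y z) i).trans hz
    rw [Real.norm_eq_abs] at this ⊢
    linarith [hz1 i, abs_nonneg (h z i)]
  have hint : ∀ i, (∫ w, h w ∂P) i = ∫ w, H i w ∂P := fun i =>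
    eval_integral (f := fun w => h w) (fun i => Integrable.of_bound (hH i) |4 * A * b| (by
      filter_upwards [hhb] with z hz using (norm_le_pi_norm (h z) i).trans hz)) i
  have hsym := integral_expSup_le_symIter hhm hym hhb hyb h1' h2' n
    (fun i => ∑ j, θ i j * (-(n * q * D j + Real.log (1 / π j))))
  refine le_trans (le_of_eq ?_) (hsym.trans ((symIter_le_sum θ hθ hvm hvb (fun _ _ => rfl) n
    _).trans ?_))
  · refine integral_congr_ae (ae_of_all _ fun z => ?_)
    simp only
    congr 1
    ext i
    simp only [Pi.add_apply, Finset.sum_apply, Pi.sub_apply, hint, empDev, mul_neg,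
      Finset.sum_neg_distrib]
    ring
  · refine le_of_le_of_eq (Finset.sum_le_sum fun j _ => ?_) hπ1
    have hDi : Integrable (fun z => v j z ^ 2) P := by
      refine Integrable.of_bound ((hvm j).pow 2) ((4 * A * b) ^ 2) ?_
      filter_upwards [hvb j] with z hz
      rw [norm_pow]
      exact pow_le_pow_left₀ (norm_nonneg _) hz 2
    -- Here 252/100 = 4 · 63/100, the 4 coming from the square of 2A.
    have hcosh : ∫ z, Real.cosh (v j z) ∂P ≤ Real.exp (q * D j) := by
      calc ∫ z, Real.cosh (v j z) ∂P ≤ ∫ z, (1 + 63 / 100 * v j z ^ 2) ∂P := by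
            refine integral_mono_of_nonneg (ae_of_all _ fun z => (Real.cosh_pos _).le)
              ((integrable_const _).add (hDi.const_mul _)) ?_
            filter_upwards [hvb j] with z hz
            refine cosh_le_one_add ?_
            rw [← sq_abs]
            calc |v j z| ^ 2 ≤ (4 * A * b) ^ 2 := pow_le_pow_left₀ (abs_nonneg _) hz 2
              _ ≤ _ := by linarith
        _ = 1 + 252 / 100 * A ^ 2 * D j := by
            rw [integral_add (integrable_const _) (hDi.const_mul _), integral_const_mul]
            simp only [hv, mul_pow, integral_const_mul, hD]
            simp
            ring
        _ ≤ 1 + q * D j := by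
            have : 0 ≤ D j := integral_nonneg fun z => sq_nonneg _
            gcongr
        _ ≤ Real.exp (q * D j) := by linarith [Real.add_one_le_exp (q * D j)]
    -- The compensator n q D j cancels the n cosh factors and leaves exp (−log (1/π j)) = π j; the
    -- sum over vertices is then the total prior mass.
    calc Real.exp (-(n * q * D j + Real.log (1 / π j))) * (∫ z, Real.cosh (v j z) ∂P) ^ n
        ≤ Real.exp (-(n * q * D j + Real.log (1 / π j))) * Real.exp (q * D j) ^ n := by
          have : 0 ≤ ∫ z, Real.cosh (v j z) ∂P := integral_nonneg fun z => (Real.cosh_pos _).le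
          gcongr
      _ = π j := by
          rw [← Real.exp_nat_mul, ← Real.exp_add, one_div, Real.log_inv]
          rw [show -(n * q * D j + -Real.log (π j)) + n * (q * D j) = Real.log (π j) by ring,
            Real.exp_log (hπ j)]

/-- Bernstein's argument: second-order expansion of exp (−G), integration, then 1 + x ≤ exp x. -/
theorem integral_exp_sub_le {G : 𝒵 → ℝ} (hG : AEStronglyMeasurable G P) {x : ℝ}
    (hx : 3 * x < 10) (hGx : ∀ᵐ z ∂P, |G z| ≤ x) :
    ∫ z, Real.exp ((∫ w, G w ∂P) - G z) ∂P
      ≤ Real.exp (57 / 100 / (1 - 3 / 10 * x) * ∫ z, G z ^ 2 ∂P) := by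
  set c := 57 / 100 / (1 - 3 / 10 * x)
  set m := ∫ w, G w ∂P
  have hGi : Integrable G P := Integrable.of_bound hG x hGx
  have hG2 : Integrable (fun z => G z ^ 2) P := by
    refine Integrable.of_bound (hG.pow 2) (x ^ 2) ?_
    filter_upwards [hGx] with z hz
    rw [norm_pow]
    exact pow_le_pow_left₀ (norm_nonneg _) hz 2
  have hb : ∫ z, Real.exp (-G z) ∂P ≤ ∫ z, (1 - G z + c * G z ^ 2) ∂P := by
    refine integral_mono_of_nonneg (ae_of_all _ fun z => (Real.exp_pos _).le)
      (((integrable_const _).sub hGi).add (hG2.const_mul _)) ?_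
    filter_upwards [hGx] with z hz
    have h1 := exp_sub_one_sub_id_le (u := -G z) (by rw [abs_neg]; linarith)
    rw [abs_neg, neg_sq] at h1
    have h2 : 57 / 100 * G z ^ 2 / (1 - 3 / 10 * |G z|) ≤ c * G z ^ 2 := by
      rw [show c * G z ^ 2 = 57 / 100 * G z ^ 2 / (1 - 3 / 10 * x) by simp only [c]; ring]
      apply div_le_div_of_nonneg_left (by positivity) (by linarith) (by linarith)
    linarith
  have he : ∫ z, (1 - G z + c * G z ^ 2) ∂P = 1 - m + c * ∫ z, G z ^ 2 ∂P := by
    have hi : Integrable (fun z => 1 - G z) P := (integrable_const _).sub hGi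
    rw [integral_add hi (hG2.const_mul _), integral_sub (integrable_const _) hGi,
      integral_const_mul]
    simp [m]
  simp only [sub_eq_add_neg, Real.exp_add, integral_const_mul]
  calc Real.exp m * ∫ z, Real.exp (-G z) ∂P
      ≤ Real.exp m * Real.exp (-m + c * ∫ z, G z ^ 2 ∂P) := by
        gcongr
        rw [he] at hb
        linarith [Real.add_one_le_exp (-m + c * ∫ z, G z ^ 2 ∂P)]
    _ = _ := by rw [← Real.exp_add]; ring_nf

theorem integral_exp_empDev_le {G : 𝒵 → ℝ} (hG : AEStronglyMeasurable G P) {x : ℝ}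
    (hx : 3 * x < 10) (hGx : ∀ᵐ z ∂P, |G z| ≤ x) :
    ∫ z, Real.exp (empDev P G z) ∂(Measure.pi fun _ : Fin n => P)
      ≤ Real.exp (n * (57 / 100 / (1 - 3 / 10 * x) * ∫ z, G z ^ 2 ∂P)) := by
  simp only [empDev, Real.exp_sum]
  rw [integral_fintype_prod_eq_pow (fun z => Real.exp ((∫ w, G w ∂P) - G z)), Fintype.card_fin,
    Real.exp_nat_mul]
  exact pow_le_pow_left₀ (integral_nonneg fun z => (Real.exp_pos _).le)
    (integral_exp_sub_le hG hx hGx) n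

/-- A bound for finite subfamilies extends to all of a separable family of continuous paths. -/
theorem measure_exists_pos_le {α Ω : Type*} [TopologicalSpace α] [MeasurableSpace Ω]
    {μ : Measure Ω} {S : Set α} [TopologicalSpace.SeparableSpace S] [Nonempty S]
    {E : α → Ω → ℝ} {ε : ENNReal}
    (hfin : ∀ (k : ℕ) (s : Fin (k + 1) → α), (∀ i, s i ∈ S) → μ {ω | ∃ i, 0 < E (s i) ω} ≤ ε)
    (hcont : ∀ᵐ ω ∂μ, ContinuousOn (fun θ => E θ ω) S) :
    μ {ω | ∃ θ ∈ S, 0 < E θ ω} ≤ ε := by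
  let d := TopologicalSpace.denseSeq S
  let U : ℕ → Set Ω := fun k => {ω | ∃ i : Fin (k + 1), 0 < E (d i) ω}
  have hU : Monotone U := by
    intro k l hkl ω ⟨i, hi⟩
    exact ⟨⟨i, by omega⟩, hi⟩
  have hle : μ {ω | ∃ θ ∈ S, 0 < E θ ω} ≤ μ (⋃ k, U k) := by
    refine measure_mono_ae ?_
    filter_upwards [hcont] with ω hω ⟨θ, hθ, hpos⟩
    have hc : Continuous (fun t : S => E t ω) := continuousOn_iff_continuous_domRestrict.1 hω
    -- The strict inequality cuts out an open subset of S, which the dense sequence must meet.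
    obtain ⟨t, ht, k, hk⟩ := (TopologicalSpace.denseRange_denseSeq S).inter_open_nonempty
      {t : S | 0 < E t ω} (isOpen_lt continuous_const hc) ⟨⟨θ, hθ⟩, hpos⟩
    refine Set.mem_iUnion.2 ⟨k, ⟨⟨k, by omega⟩, ?_⟩⟩
    change 0 < E (d k) ω
    rw [show d k = t from hk]
    exact ht
  refine hle.trans ?_
  rw [hU.measure_iUnion]
  exact iSup_le fun k => hfin k (fun i => d i) fun i => (d i).2

end

/-! ### The deviation bound, uniform over the simplex -/

section

/-- Merges the nonlinear and the linear part without any independence: the right side has mean at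
most 1 as soon as exp a and the sum of the exp (c j) do. -/
theorem exp_convex_comb_le {M : ℕ} {θ : Fin M → ℝ} (hθ : θ ∈ stdSimplex ℝ (Fin M)) {s t : ℝ}
    (hs : 0 < s) (ht : 0 < t) (a : ℝ) (c : Fin M → ℝ) :
    Real.exp ((s * a + t * ∑ j, θ j * c j) / (s + t))
      ≤ s / (s + t) * Real.exp a + t / (s + t) * ∑ j, Real.exp (c j) := by
  have h1 := convexOn_exp.2 (Set.mem_univ a) (Set.mem_univ (∑ j, θ j * c j))
    (by positivity : 0 ≤ s / (s + t)) (by positivity : 0 ≤ t / (s + t)) (by field_simp)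
  have h2 := convexOn_exp.map_sum_le (t := Finset.univ) (w := θ) (p := c)
      (fun j _ => hθ.1 j) hθ.2 (fun _ _ => Set.mem_univ _)
  simp only [smul_eq_mul] at h1 h2
  have h3 : ∑ j, θ j * Real.exp (c j) ≤ ∑ j, Real.exp (c j) := by
    refine Finset.sum_le_sum fun j _ => mul_le_of_le_one_left (Real.exp_pos _).le ?_
    rw [← hθ.2]
    exact Finset.single_le_sum (fun k _ => hθ.1 k) (Finset.mem_univ j)
  calc _ = Real.exp (s / (s + t) * a + t / (s + t) * ∑ j, θ j * c j) := by congr 1; ring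
    _ ≤ _ := h1
    _ ≤ _ := by gcongr; exact h2.trans h3

theorem vertex_mem {M : ℕ} (j : Fin M) : vertex j ∈ stdSimplex ℝ (Fin M) :=
  single_mem_stdSimplex ℝ j

theorem sum_vertex_mul {M : ℕ} (j : Fin M) (x : Fin M → ℝ) : ∑ k, vertex j k * x k = x j := by
  simp [vertex, Pi.single_apply]

variable {𝒵 : Type*} [MeasurableSpace 𝒵] {P : Measure 𝒵} [IsProbabilityMeasure P] {M n : ℕ}

/-- The hypotheses on a family of losses indexed by weights: Lipschitz in the prediction and bounded,
for bounded candidates. -/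
structure BoundedLipschitzFamily (P : Measure 𝒵) (F : Fin M → 𝒵 → ℝ) (L : (Fin M → ℝ) → 𝒵 → ℝ)
    (b Cb : ℝ) : Prop where
  meas_cand : ∀ j, AEStronglyMeasurable (F j) P
  cand_le : ∀ᵐ z ∂P, ∀ j, |F j z| ≤ b
  meas_loss : ∀ θ ∈ stdSimplex ℝ (Fin M), AEStronglyMeasurable (L θ) P
  nonneg : 0 ≤ Cb
  lipschitz : ∀ᵐ z ∂P, ∀ θ ∈ stdSimplex ℝ (Fin M), ∀ θ' ∈ stdSimplex ℝ (Fin M),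
    |L θ z - L θ' z| ≤ Cb * |∑ j, θ j * F j z - ∑ j, θ' j * F j z|
  loss_le : ∀ᵐ z ∂P, ∀ θ ∈ stdSimplex ℝ (Fin M), |L θ z| ≤ b

/-- The mixture of a loss family with its linear interpolation from the vertices. -/
noncomputable def mixFamily (L : (Fin M → ℝ) → 𝒵 → ℝ) (ν : ℝ) (θ : Fin M → ℝ) (z : 𝒵) : ℝ :=
  (1 - ν) * L θ z + ν * ∑ j, θ j * L (vertex j) z

namespace BoundedLipschitzFamily

variable {F : Fin M → 𝒵 → ℝ} {L : (Fin M → ℝ) → 𝒵 → ℝ} {b Cb : ℝ}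

theorem integrable_loss (h : BoundedLipschitzFamily P F L b Cb) {θ : Fin M → ℝ}
    (hθ : θ ∈ stdSimplex ℝ (Fin M)) : Integrable (L θ) P :=
  Integrable.of_bound (h.meas_loss θ hθ) b (by filter_upwards [h.loss_le] with z hz using hz θ hθ)

theorem integrable_mixFamily (h : BoundedLipschitzFamily P F L b Cb) (ν : ℝ) {θ : Fin M → ℝ}
    (hθ : θ ∈ stdSimplex ℝ (Fin M)) : Integrable (mixFamily L ν θ) P :=
  ((h.integrable_loss hθ).const_mul _).add
    ((integrable_finsetSum _ fun j _ => (h.integrable_loss (vertex_mem j)).const_mul _).const_mul _)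

omit [MeasurableSpace 𝒵] in
theorem abs_mixFamily_sub_le {ν : ℝ} (hν : ν ∈ Set.Icc (0 : ℝ) 1) (hCb : 0 ≤ Cb) {z : 𝒵}
    (hF : ∀ j, |F j z| ≤ b) {θ θ' : Fin M → ℝ}
    (hLip : |L θ z - L θ' z| ≤ Cb * |∑ j, θ j * F j z - ∑ j, θ' j * F j z|)
    (hL : ∀ j, |L (vertex j) z| ≤ b) :
    |mixFamily L ν θ z - mixFamily L ν θ' z| ≤ (Cb + 1) * b * ∑ j, |θ j - θ' j| := by
  have hsum : ∀ x : Fin M → ℝ, (∀ j, |x j| ≤ b) →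
      |∑ j, θ j * x j - ∑ j, θ' j * x j| ≤ b * ∑ j, |θ j - θ' j| := fun x hx => by
    rw [← Finset.sum_sub_distrib, Finset.mul_sum]
    refine (Finset.abs_sum_le_sum_abs _ _).trans (Finset.sum_le_sum fun j _ => ?_)
    rw [← sub_mul, abs_mul, mul_comm]
    exact mul_le_mul_of_nonneg_right (hx j) (abs_nonneg _)
  have e : mixFamily L ν θ z - mixFamily L ν θ' z = (1 - ν) * (L θ z - L θ' z)
      + ν * (∑ j, θ j * L (vertex j) z - ∑ j, θ' j * L (vertex j) z) := by
    simp only [mixFamily]; ring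
  have h1 := hLip.trans (mul_le_mul_of_nonneg_left (hsum (fun j => F j z) hF) hCb)
  have h2 := hsum (fun j => L (vertex j) z) hL
  rw [e]
  refine (abs_add_le _ _).trans ?_
  rw [abs_mul, abs_mul, abs_of_nonneg hν.1, abs_of_nonneg (sub_nonneg.2 hν.2)]
  have h3 := mul_le_mul_of_nonneg_left h1 (sub_nonneg.2 hν.2)
  have h4 := mul_le_mul_of_nonneg_left h2 hν.1
  have h5 := (abs_nonneg _).trans h1
  have h6 := (abs_nonneg _).trans h2
  have h7 := mul_nonneg hν.1 h5
  have h8 := mul_nonneg (sub_nonneg.2 hν.2) h6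
  linarith

theorem ae_continuousOn_empDev (h : BoundedLipschitzFamily P F L b Cb) {ν : ℝ}
    (hν : ν ∈ Set.Icc (0 : ℝ) 1) {θ₀ : Fin M → ℝ} (hθ₀ : θ₀ ∈ stdSimplex ℝ (Fin M)) :
    ∀ᵐ z ∂(Measure.pi fun _ : Fin n => P), ContinuousOn
      (fun θ => empDev P (fun w => mixFamily L ν θ w - mixFamily L ν θ₀ w) z)
      (stdSimplex ℝ (Fin M)) := by
  have hgood : ∀ᵐ w ∂P, ∀ θ ∈ stdSimplex ℝ (Fin M), ∀ θ' ∈ stdSimplex ℝ (Fin M),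
      |mixFamily L ν θ w - mixFamily L ν θ' w| ≤ (Cb + 1) * b * ∑ j, |θ j - θ' j| := by
    filter_upwards [h.cand_le, h.lipschitz, h.loss_le] with w h1 h2 h3 θ hθ θ' hθ'
    exact abs_mixFamily_sub_le hν h.nonneg h1 (h2 θ hθ θ' hθ') fun j => h3 _ (vertex_mem j)
  filter_upwards [ae_pi_forall hgood] with z hz
  intro θ' hθ'
  rw [ContinuousWithinAt, tendsto_iff_dist_tendsto_zero]
  have hlim : Filter.Tendsto (fun θ : Fin M → ℝ => n * (2 * ((Cb + 1) * b * ∑ j, |θ j - θ' j|)))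
      (nhdsWithin θ' (stdSimplex ℝ (Fin M))) (nhds 0) := by
    have : Continuous (fun θ : Fin M → ℝ => n * (2 * ((Cb + 1) * b * ∑ j, |θ j - θ' j|))) := by
      fun_prop
    have h0 := this.tendsto θ'
    simp only [sub_self, abs_zero, Finset.sum_const_zero, mul_zero] at h0
    exact h0.mono_left nhdsWithin_le_nhds
  refine squeeze_zero' (Filter.Eventually.of_forall fun _ => dist_nonneg) ?_ hlim
  filter_upwards [self_mem_nhdsWithin] with θ hθ
  have i : ∀ {θ : Fin M → ℝ}, θ ∈ stdSimplex ℝ (Fin M) → Integrable (mixFamily L ν θ) P :=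
    fun hθ => h.integrable_mixFamily ν hθ
  have e : empDev P (fun w => mixFamily L ν θ w - mixFamily L ν θ₀ w) z
      - empDev P (fun w => mixFamily L ν θ' w - mixFamily L ν θ₀ w) z
      = empDev P (fun w => mixFamily L ν θ w - mixFamily L ν θ' w) z := by
    simp only [empDev]
    rw [← Finset.sum_sub_distrib, integral_sub (i hθ) (i hθ₀), integral_sub (i hθ') (i hθ₀),
      integral_sub (i hθ) (i hθ')]
    exact Finset.sum_congr rfl fun k _ => by ring
  rw [Real.dist_eq, e]
  refine abs_empDev_le ?_ fun k => hz k θ hθ θ' hθ'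
  filter_upwards [hgood] with w hw using hw θ hθ θ' hθ'

/-- Deviation bound for finitely many weights. -/
theorem measure_finite_excess_le (h : BoundedLipschitzFamily P F L b Cb) (hb : 0 ≤ b) {ν μ s t : ℝ}
    (hν : ν ∈ Set.Icc (0 : ℝ) 1) (hμ : 0 < μ) (hs : 0 < s) (ht : 0 < t)
    (hs1 : 16 * ((1 - ν) * Cb * b) ^ 2 ≤ 25 / 12 * s ^ 2)
    (hs2 : 8 / 5 * ((1 - ν) * Cb) ^ 2 ≤ μ * s)
    (ht1 : 3 / 5 * (ν * Cb * b) < t)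
    (ht2 : 3 / 5 * ((ν * Cb) ^ 2 + μ * (ν * Cb * b)) ≤ μ * t)
    {π : Fin M → ℝ} (hπ : ∀ j, 0 < π j) (hπ1 : ∑ j, π j = 1)
    {θ₀ : Fin M → ℝ} (hθ₀ : θ₀ ∈ stdSimplex ℝ (Fin M)) {δ : ℝ} (hδ : 0 < δ)
    {D : Fin M → ℝ} (hD : ∀ j, D j = ∫ w, (F j w - ∑ k, θ₀ k * F k w) ^ 2 ∂P)
    {ι : Type*} [Fintype ι] [Nonempty ι] {θ : ι → Fin M → ℝ}
    (hθ : ∀ i, θ i ∈ stdSimplex ℝ (Fin M)) :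
    (Measure.pi fun _ : Fin n => P) {z | ∃ i, 0 <
        empDev P (fun w => mixFamily L ν (θ i) w - mixFamily L ν θ₀ w) z
        - n * (μ * (63 / 40 * ∑ j, θ i j * D j
          + 19 / 20 * (∑ j, θ i j * D j + ∑ j, θ₀ j * D j)))
        - (s + t) * (∑ j, θ i j * Real.log (1 / π j) + Real.log (1 / δ))} ≤ ENNReal.ofReal δ := by
  set V := ∑ j, θ₀ j * D j with hV
  set H : ι → 𝒵 → ℝ := fun i w => (1 - ν) / s * (L (θ i) w - L θ₀ w) with hH
  set G : Fin M → 𝒵 → ℝ := fun j w =>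
    ν / t * (L (vertex j) w - ∑ k, θ₀ k * L (vertex k) w) with hG
  have h1ν : 0 ≤ 1 - ν := sub_nonneg.2 hν.2
  have hν0 := hν.1
  have hCb := h.nonneg
  have hHm : ∀ i, AEStronglyMeasurable (H i) P := fun i =>
    ((h.meas_loss _ (hθ i)).sub (h.meas_loss _ hθ₀)).const_mul _
  have hGm : ∀ j, AEStronglyMeasurable (G j) P := fun j =>
    ((h.meas_loss _ (vertex_mem j)).sub (Finset.aestronglyMeasurable_fun_sum _ fun k _ =>
      (h.meas_loss _ (vertex_mem k)).const_mul _)).const_mul _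
  have hscale : ∀ {x y : ℝ}, |x| ≤ Cb * |y| → |(1 - ν) / s * x| ≤ (1 - ν) * Cb / s * |y| := by
    intro x y hxy
    rw [abs_mul, abs_of_nonneg (by positivity : 0 ≤ (1 - ν) / s),
      show (1 - ν) * Cb / s * |y| = (1 - ν) / s * (Cb * |y|) by ring]
    gcongr
  have hexp1 := integral_expSup_empDev_le (n := n) h.meas_cand h.cand_le hθ hθ₀ hHm
    (A := (1 - ν) * Cb / s) (q := μ * (63 / 40) / s) (by positivity)
    (by filter_upwards [h.lipschitz] with w hw i using hscale (hw _ (hθ i) _ hθ₀))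
    (by
      filter_upwards [h.lipschitz] with w hw i k
      have e : H i w - H k w = (1 - ν) / s * (L (θ i) w - L (θ k) w) := by simp only [hH]; ring
      rw [e]
      exact hscale (hw _ (hθ i) _ (hθ k)))
    (by
      rw [show 16 * ((1 - ν) * Cb / s) ^ 2 * b ^ 2 = 16 * ((1 - ν) * Cb * b) ^ 2 / s ^ 2 by ring,
        div_le_iff₀ (by positivity)]
      exact hs1)
    (by
      rw [show 252 / 100 * ((1 - ν) * Cb / s) ^ 2 = 63 / 40 * (8 / 5 * ((1 - ν) * Cb) ^ 2) / s ^ 2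
        by ring, div_le_div_iff₀ (by positivity) hs]
      nlinarith [mul_le_mul_of_nonneg_right hs2 hs.le])
    hπ hπ1
  simp only [← hD] at hexp1
  have hlip : ∀ᵐ w ∂P, ∀ j, |G j w| ≤ ν / t * (Cb * ∑ k, θ₀ k * |F j w - F k w|) := by
    filter_upwards [h.lipschitz] with w hw j
    rw [hG]
    simp only
    rw [abs_mul, abs_of_nonneg (by positivity : 0 ≤ ν / t)]
    gcongr
    have e : L (vertex j) w - ∑ k, θ₀ k * L (vertex k) w
        = ∑ k, θ₀ k * (L (vertex j) w - L (vertex k) w) := by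
      simp only [mul_sub, Finset.sum_sub_distrib]
      rw [← Finset.sum_mul, hθ₀.2, one_mul]
    rw [e, Finset.mul_sum]
    refine (Finset.abs_sum_le_sum_abs _ _).trans (Finset.sum_le_sum fun k _ => ?_)
    rw [abs_mul, abs_of_nonneg (hθ₀.1 k)]
    have := hw _ (vertex_mem j) _ (vertex_mem k)
    rw [sum_vertex_mul, sum_vertex_mul] at this
    nlinarith [mul_le_mul_of_nonneg_left this (hθ₀.1 k)]
  have hGx : ∀ j, ∀ᵐ w ∂P, |G j w| ≤ 2 * (ν * Cb * b) / t := fun j => by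
    filter_upwards [hlip, h.cand_le] with w hw hF
    refine (hw j).trans ?_
    have : ∑ k, θ₀ k * |F j w - F k w| ≤ 2 * b := by
      refine (le_abs_self _).trans (abs_sum_mul_le hθ₀ fun k => ?_)
      rw [abs_abs]
      exact (abs_sub _ _).trans (by linarith [hF j, hF k])
    calc ν / t * (Cb * ∑ k, θ₀ k * |F j w - F k w|) ≤ ν / t * (Cb * (2 * b)) := by gcongr
      _ = _ := by ring
  have hF0 : AEStronglyMeasurable (fun w => ∑ k, θ₀ k * F k w) P :=
    Finset.aestronglyMeasurable_fun_sum _ fun k _ => (h.meas_cand k).const_mul _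
  have hDi : ∀ j, Integrable (fun w => (F j w - ∑ k, θ₀ k * F k w) ^ 2) P := fun j => by
    refine Integrable.of_bound (((h.meas_cand j).sub hF0).pow 2) ((2 * b) ^ 2) ?_
    filter_upwards [h.cand_le] with w hw
    rw [norm_pow]
    refine pow_le_pow_left₀ (norm_nonneg _) ?_ 2
    exact (abs_sub _ _).trans (by linarith [hw j, abs_sum_mul_le hθ₀ hw])
  have hG2 : ∀ j, ∫ w, G j w ^ 2 ∂P ≤ (ν * Cb / t) ^ 2 * (D j + V) := fun j => by
    have e : (ν * Cb / t) ^ 2 * (D j + V) = ∫ w, (ν * Cb / t) ^ 2 *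
        ((F j w - ∑ k, θ₀ k * F k w) ^ 2
          + ∑ l, θ₀ l * (F l w - ∑ k, θ₀ k * F k w) ^ 2) ∂P := by
      rw [integral_const_mul, integral_add (hDi j)
        (integrable_finsetSum _ fun l _ => (hDi l).const_mul _),
        integral_finsetSum _ fun l _ => (hDi l).const_mul _]
      simp only [integral_const_mul, ← hD, hV]
    rw [e]
    refine integral_mono_of_nonneg (ae_of_all _ fun w => sq_nonneg _) (((hDi j).add
      (integrable_finsetSum _ fun l _ => (hDi l).const_mul _)).const_mul _) ?_
    filter_upwards [hlip] with w hw
    -- Jensen, then the variance decomposition of the θ₀-average of (F j − F k)² about its mean m.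
    -- The second term is the origin of V(θ₀) in the deviation bound, hence of the term κV in the
    -- choice of θ₀.
    have hcs : (∑ k, θ₀ k * |F j w - F k w|) ^ 2 ≤ (F j w - ∑ k, θ₀ k * F k w) ^ 2
          + ∑ l, θ₀ l * (F l w - ∑ k, θ₀ k * F k w) ^ 2 := by
      set m := ∑ k, θ₀ k * F k w with hm
      have hj := (convexOn_pow (𝕜 := ℝ) 2).map_sum_le (t := Finset.univ) (w := θ₀)
        (p := fun k => |F j w - F k w|) (fun k _ => hθ₀.1 k) hθ₀.2 (fun k _ => Set.mem_Ici.2 (abs_nonneg _))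
      simp only [smul_eq_mul, sq_abs] at hj
      refine hj.trans (le_of_eq ?_)
      have e1 : ∀ k, θ₀ k * (F j w - F k w) ^ 2 = (F j w - m) ^ 2 * θ₀ k
          + θ₀ k * (F k w - m) ^ 2 - 2 * (F j w - m) * (θ₀ k * F k w - m * θ₀ k) := fun k => by
        ring
      simp only [e1, Finset.sum_sub_distrib, Finset.sum_add_distrib, ← Finset.mul_sum, hθ₀.2, ← hm]
      ring
    calc G j w ^ 2 = |G j w| ^ 2 := (sq_abs _).symm
      _ ≤ (ν / t * (Cb * ∑ k, θ₀ k * |F j w - F k w|)) ^ 2 :=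
        pow_le_pow_left₀ (abs_nonneg _) (hw j) 2
      _ = (ν * Cb / t) ^ 2 * (∑ k, θ₀ k * |F j w - F k w|) ^ 2 := by ring
      _ ≤ _ := by gcongr
  have hDV : ∀ j, 0 ≤ D j + V := fun j => by
    have : ∀ l, 0 ≤ D l := fun l => by rw [hD]; exact integral_nonneg fun w => sq_nonneg _
    exact add_nonneg (this j) (Finset.sum_nonneg fun l _ => mul_nonneg (hθ₀.1 l) (this l))
  have hexp2 : ∀ j, ∫ z, Real.exp (empDev P (G j) z) ∂(Measure.pi fun _ : Fin n => P)
      ≤ Real.exp (n * (μ * (19 / 20) / t * (D j + V))) := fun j => by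
    refine (integral_exp_empDev_le (hGm j) (x := 2 * (ν * Cb * b) / t) ?_ (hGx j)).trans ?_
    · rw [mul_div_assoc', div_lt_iff₀ ht]; linarith
    · refine Real.exp_le_exp.2 (mul_le_mul_of_nonneg_left ?_ n.cast_nonneg)
      have hpos : 0 < 1 - 3 / 10 * (2 * (ν * Cb * b) / t) := by
        rw [mul_div_assoc', sub_pos, div_lt_one ht]; linarith
      calc 57 / 100 / (1 - 3 / 10 * (2 * (ν * Cb * b) / t)) * ∫ z, G j z ^ 2 ∂P
          ≤ 57 / 100 / (1 - 3 / 10 * (2 * (ν * Cb * b) / t))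
              * ((ν * Cb / t) ^ 2 * (D j + V)) := by
            gcongr
            exact hG2 j
        _ = 57 / 100 * (ν * Cb / t) ^ 2 / (1 - 3 / 10 * (2 * (ν * Cb * b) / t)) * (D j + V) := by
            ring
        _ ≤ _ := by
            refine mul_le_mul_of_nonneg_right ?_ (hDV j)
            rw [div_le_iff₀ hpos]
            rw [show μ * (19 / 20) / t * (1 - 3 / 10 * (2 * (ν * Cb * b) / t))
              = 19 / 20 * (μ * t - 3 / 5 * (μ * (ν * Cb * b))) / t ^ 2 by field_simp; ring,
              show 57 / 100 * (ν * Cb / t) ^ 2 = 57 / 100 * (ν * Cb) ^ 2 / t ^ 2 by ring]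
            -- Since 57/100 = 19/20 · 3/5, what remains is `ht2` times 19/20.
            refine div_le_div_of_nonneg_right ?_ (by positivity)
            linarith
  set a : (Fin n → 𝒵) → ι → ℝ := fun z i => empDev P (H i) z - ∑ j, θ i j *
    (n * (μ * (63 / 40) / s) * D j + Real.log (1 / π j)) with ha
  set c : Fin M → (Fin n → 𝒵) → ℝ := fun j z => empDev P (G j) z
    - (n * (μ * (19 / 20) / t * (D j + V)) + Real.log (1 / π j)) with hc
  have hHx : ∀ i, ∀ᵐ w ∂P, |H i w| ≤ (1 - ν) * Cb / s * (2 * b) := fun i => by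
    filter_upwards [h.lipschitz, h.cand_le] with w hw hF
    refine (hscale (hw _ (hθ i) _ hθ₀)).trans ?_
    gcongr
    exact (abs_sub _ _).trans (by linarith [abs_sum_mul_le (hθ i) hF, abs_sum_mul_le hθ₀ hF])
  have ham : AEStronglyMeasurable a (Measure.pi fun _ : Fin n => P) :=
    (aemeasurable_pi_iff.2 fun i => ((aestronglyMeasurable_empDev (hHm i)).sub
      aestronglyMeasurable_const).aemeasurable).aestronglyMeasurable
  have hint1 : Integrable (fun z => expSup (a z)) (Measure.pi fun _ : Fin n => P) := by
    set B := fun i => n * (2 * ((1 - ν) * Cb / s * (2 * b))) + |∑ j, θ i j *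
      (n * (μ * (63 / 40) / s) * D j + Real.log (1 / π j))| with hB
    have hB0 : ∀ i, 0 ≤ B i := fun i => by positivity
    refine integrable_comp_of_continuous isSignContractive_expSup.continuous ham
      (B := ∑ i, B i) ?_
    filter_upwards [ae_all_iff.2 fun i => ae_abs_empDev_le (n := n) (hHx i)] with z hz
    refine (pi_norm_le_iff_of_nonneg (Finset.sum_nonneg fun i _ => hB0 i)).2 fun i => ?_
    refine le_trans ?_ (Finset.single_le_sum (fun i _ => hB0 i) (Finset.mem_univ i))
    exact (abs_sub _ _).trans (add_le_add_left (hz i) _)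
  have hint2 : ∀ j, Integrable (fun z => Real.exp (c j z)) (Measure.pi fun _ : Fin n => P) :=
    fun j => by
      refine Integrable.of_bound (Real.continuous_exp.comp_aestronglyMeasurable
        ((aestronglyMeasurable_empDev (hGm j)).sub aestronglyMeasurable_const))
        (Real.exp (n * (2 * (2 * (ν * Cb * b) / t))
          - (n * (μ * (19 / 20) / t * (D j + V)) + Real.log (1 / π j)))) ?_
      filter_upwards [ae_abs_empDev_le (n := n) (hGx j)] with z hz
      rw [Real.norm_eq_abs, abs_of_pos (Real.exp_pos _)]
      exact Real.exp_le_exp.2 (sub_le_sub_right ((le_abs_self _).trans hz) _)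
  have hsum2 : ∫ z, ∑ j, Real.exp (c j z) ∂(Measure.pi fun _ : Fin n => P) ≤ 1 := by
    rw [integral_finsetSum _ fun j _ => hint2 j]
    refine le_of_le_of_eq (Finset.sum_le_sum fun j _ => ?_) hπ1
    have e : ∀ z, Real.exp (c j z) = Real.exp (-(n * (μ * (19 / 20) / t * (D j + V))
        + Real.log (1 / π j))) * Real.exp (empDev P (G j) z) := fun z => by
      rw [← Real.exp_add]; congr 1; simp only [hc]; ring
    simp only [e]
    rw [integral_const_mul]
    refine (mul_le_mul_of_nonneg_left (hexp2 j) (Real.exp_pos _).le).trans (le_of_eq ?_)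
    rw [← Real.exp_add, one_div, Real.log_inv, neg_add, neg_neg, add_right_comm, neg_add_cancel,
      zero_add, Real.exp_log (hπ j)]
  -- Z does not depend on i and has mean at most 1, so a single use of Markov's inequality at level
  -- 1/δ covers all weights.
  set Z : (Fin n → 𝒵) → ℝ := fun z =>
    s / (s + t) * expSup (a z) + t / (s + t) * ∑ j, Real.exp (c j z) with hZ
  have hZi : Integrable Z (Measure.pi fun _ : Fin n => P) :=
    (hint1.const_mul _).add ((integrable_finsetSum _ fun j _ => hint2 j).const_mul _)
  have hZ0 : ∀ z, 0 ≤ Z z := fun z =>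
    add_nonneg (mul_nonneg (by positivity) (expSup_nonneg _))
      (mul_nonneg (by positivity) (Finset.sum_nonneg fun j _ => (Real.exp_pos _).le))
  have hZ1 : ∫ z, Z z ∂(Measure.pi fun _ : Fin n => P) ≤ 1 := by
    rw [hZ, integral_add (hint1.const_mul _)
      ((integrable_finsetSum _ fun j _ => hint2 j).const_mul _), integral_const_mul,
      integral_const_mul]
    calc _ ≤ s / (s + t) * 1 + t / (s + t) * 1 := by gcongr
      _ = 1 := by field_simp
  have hmarkov : (Measure.pi fun _ : Fin n => P) {z | 1 / δ ≤ Z z} ≤ ENNReal.ofReal δ := by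
    have h1 := mul_meas_ge_le_integral_of_nonneg (ae_of_all _ hZ0) hZi (1 / δ)
    have h2 : (Measure.pi fun _ : Fin n => P).real {z | 1 / δ ≤ Z z} ≤ δ := by
      have := h1.trans hZ1
      rwa [one_div, inv_mul_le_iff₀ hδ, mul_one, ← one_div] at this
    rw [← ofReal_measureReal]
    exact ENNReal.ofReal_le_ofReal h2
  refine (measure_mono ?_).trans hmarkov
  rintro z ⟨i, hi⟩
  have hGi : ∀ j, Integrable (G j) P := fun j => Integrable.of_bound (hGm j) _ (hGx j)
  have hHi : Integrable (H i) P := Integrable.of_bound (hHm i) _ (hHx i)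
  have hdec : empDev P (fun w => mixFamily L ν (θ i) w - mixFamily L ν θ₀ w) z
      = s * empDev P (H i) z + t * ∑ j, θ i j * empDev P (G j) z := by
    have e : (fun w => mixFamily L ν (θ i) w - mixFamily L ν θ₀ w)
        = fun w => s * H i w + t * ∑ j, θ i j * G j w := by
      ext w
      have e1 : s * H i w = (1 - ν) * (L (θ i) w - L θ₀ w) := by
        simp only [hH]; field_simp
      have e2 : t * ∑ j, θ i j * G j w
          = ν * (∑ j, θ i j * L (vertex j) w - ∑ j, θ₀ j * L (vertex j) w) := by
        have : ∀ j, θ i j * G j w = ν / t * (θ i j * L (vertex j) w)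
            - ν / t * (∑ k, θ₀ k * L (vertex k) w) * θ i j := fun j => by
          simp only [hG]; ring
        simp only [this, Finset.sum_sub_distrib, ← Finset.mul_sum, (hθ i).2]
        field_simp
      rw [e1, e2]
      simp only [mixFamily]
      ring
    rw [e, empDev_add (hHi.const_mul _)
      ((integrable_finsetSum _ fun j _ => (hGi j).const_mul _).const_mul _),
      empDev_const_mul s, empDev_const_mul t, empDev_sum _ fun j _ => (hGi j).const_mul _]
    simp only [empDev_const_mul]
  have hexc : (s + t) * Real.log (1 / δ) < s * a z i + t * ∑ j, θ i j * c j z := by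
    have e1 : s * a z i = s * empDev P (H i) z - n * (μ * (63 / 40 * ∑ j, θ i j * D j))
        - s * ∑ j, θ i j * Real.log (1 / π j) := by
      have : ∀ j, θ i j * (n * (μ * (63 / 40) / s) * D j + Real.log (1 / π j))
          = n * (μ * (63 / 40) / s) * (θ i j * D j) + θ i j * Real.log (1 / π j) := fun j => by
        ring
      simp only [ha, this, Finset.sum_add_distrib, ← Finset.mul_sum]
      field_simp
      ring
    have e2 : t * ∑ j, θ i j * c j z = t * ∑ j, θ i j * empDev P (G j) z
        - n * (μ * (19 / 20 * (∑ j, θ i j * D j + V)))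
        - t * ∑ j, θ i j * Real.log (1 / π j) := by
      have : ∀ j, θ i j * c j z = θ i j * empDev P (G j) z
          - (n * (μ * (19 / 20) / t) * (θ i j * D j) + n * (μ * (19 / 20) / t) * V * θ i j)
          - θ i j * Real.log (1 / π j) := fun j => by
        simp only [hc]; ring
      simp only [this, Finset.sum_sub_distrib, Finset.sum_add_distrib, ← Finset.mul_sum, (hθ i).2]
      field_simp
    rw [hdec] at hi
    rw [e1, e2]
    linarith
  have hst : 0 < s + t := by positivity
  calc 1 / δ = Real.exp (Real.log (1 / δ)) := (Real.exp_log (by positivity)).symm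
    _ ≤ Real.exp ((s * a z i + t * ∑ j, θ i j * c j z) / (s + t)) := by
        rw [Real.exp_le_exp, le_div_iff₀ hst, mul_comm]; exact hexc.le
    _ ≤ s / (s + t) * Real.exp (a z i) + t / (s + t) * ∑ j, Real.exp (c j z) :=
        exp_convex_comb_le (hθ i) hs ht _ _
    _ ≤ Z z := by
        rw [hZ]
        simp only
        gcongr
        exact le_expSup (a z) i

/-- Deviation bound, uniform over the simplex. -/
theorem measure_excess_le (h : BoundedLipschitzFamily P F L b Cb) (hb : 0 ≤ b) {ν μ s t : ℝ}
    (hν : ν ∈ Set.Icc (0 : ℝ) 1) (hμ : 0 < μ) (hs : 0 < s) (ht : 0 < t)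
    (hs1 : 16 * ((1 - ν) * Cb * b) ^ 2 ≤ 25 / 12 * s ^ 2)
    (hs2 : 8 / 5 * ((1 - ν) * Cb) ^ 2 ≤ μ * s)
    (ht1 : 3 / 5 * (ν * Cb * b) < t)
    (ht2 : 3 / 5 * ((ν * Cb) ^ 2 + μ * (ν * Cb * b)) ≤ μ * t)
    {π : Fin M → ℝ} (hπ : ∀ j, 0 < π j) (hπ1 : ∑ j, π j = 1)
    {θ₀ : Fin M → ℝ} (hθ₀ : θ₀ ∈ stdSimplex ℝ (Fin M)) {δ : ℝ} (hδ : 0 < δ)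
    {D : Fin M → ℝ} (hD : ∀ j, D j = ∫ w, (F j w - ∑ k, θ₀ k * F k w) ^ 2 ∂P) :
    (Measure.pi fun _ : Fin n => P) {z | ∃ θ ∈ stdSimplex ℝ (Fin M), 0 <
        empDev P (fun w => mixFamily L ν θ w - mixFamily L ν θ₀ w) z
        - n * (μ * (63 / 40 * ∑ j, θ j * D j
          + 19 / 20 * (∑ j, θ j * D j + ∑ j, θ₀ j * D j)))
        - (s + t) * (∑ j, θ j * Real.log (1 / π j) + Real.log (1 / δ))} ≤ ENNReal.ofReal δ := by
  have : Nonempty (stdSimplex ℝ (Fin M)) := ⟨⟨θ₀, hθ₀⟩⟩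
  refine measure_exists_pos_le (S := stdSimplex ℝ (Fin M)) (E := fun θ z =>
        empDev P (fun w => mixFamily L ν θ w - mixFamily L ν θ₀ w) z
        - n * (μ * (63 / 40 * ∑ j, θ j * D j
          + 19 / 20 * (∑ j, θ j * D j + ∑ j, θ₀ j * D j)))
        - (s + t) * (∑ j, θ j * Real.log (1 / π j) + Real.log (1 / δ))) ?_ ?_
  · intro k θ hθ
    exact h.measure_finite_excess_le hb hν hμ hs ht hs1 hs2 ht1 ht2 hπ hπ1 hθ₀ hδ hD hθ
  · filter_upwards [h.ae_continuousOn_empDev hν hθ₀] with z hz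
    exact (hz.sub (Continuous.continuousOn (by fun_prop))).sub
      (Continuous.continuousOn (by fun_prop))

end BoundedLipschitzFamily

end

/-! ### Geometry of strongly convex risks on the simplex -/

section

variable {M : ℕ}

/-- A risk on the simplex that is `σ`-strongly convex with respect to a quadratic distance `D`:
`slope θ j` is the derivative at `θ` in the direction of the vertex `j`. -/
structure QuadraticRisk (R : (Fin M → ℝ) → ℝ) (slope : (Fin M → ℝ) → Fin M → ℝ)
    (D : (Fin M → ℝ) → (Fin M → ℝ) → ℝ) (σ : ℝ) : Prop where
  nonneg : ∀ θ θ', 0 ≤ D θ θ'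
  self : ∀ θ, D θ θ = 0
  comm : ∀ θ θ', D θ θ' = D θ' θ
  combo : ∀ θ θ' (s : ℝ), D θ ((1 - s) • θ + s • θ') = s ^ 2 * D θ θ'
  bias : ∀ θ ∈ stdSimplex ℝ (Fin M), ∀ θ' ∈ stdSimplex ℝ (Fin M),
    ∑ j, θ j * D (vertex j) θ' = ∑ j, θ j * D (vertex j) θ + D θ θ'
  cont : ∀ θ' ∈ stdSimplex ℝ (Fin M), ContinuousOn (fun θ => D θ θ') (stdSimplex ℝ (Fin M))
  slope_self : ∀ θ ∈ stdSimplex ℝ (Fin M), ∑ j, θ j * slope θ j = 0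
  strong : ∀ θ ∈ stdSimplex ℝ (Fin M), ∀ θ' ∈ stdSimplex ℝ (Fin M),
    R θ + ∑ j, θ' j * slope θ j + σ / 2 * D θ θ' ≤ R θ'

namespace QuadraticRisk

variable {R : (Fin M → ℝ) → ℝ} {slope : (Fin M → ℝ) → Fin M → ℝ}
  {D : (Fin M → ℝ) → (Fin M → ℝ) → ℝ} {σ : ℝ}

/-- Strong convexity from θ towards each vertex, averaged with the weights θ: the first-order terms
cancel. This is the gain from the interpolated part of the mixed loss. -/
theorem add_variance_le (h : QuadraticRisk R slope D σ) {θ : Fin M → ℝ}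
    (hθ : θ ∈ stdSimplex ℝ (Fin M)) :
    R θ + σ / 2 * ∑ j, θ j * D (vertex j) θ ≤ ∑ j, θ j * R (vertex j) := by
  have h1 : ∀ j, R θ + slope θ j + σ / 2 * D (vertex j) θ ≤ R (vertex j) := fun j => by
    have := h.strong θ hθ _ (vertex_mem j)
    rwa [sum_vertex_mul, h.comm] at this
  have h2 := Finset.sum_le_sum fun j (_ : j ∈ Finset.univ) =>
    mul_le_mul_of_nonneg_left (h1 j) (hθ.1 j)
  have e : ∀ j, θ j * (R θ + slope θ j + σ / 2 * D (vertex j) θ)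
      = R θ * θ j + θ j * slope θ j + σ / 2 * (θ j * D (vertex j) θ) := fun j => by ring
  simp only [e, Finset.sum_add_distrib, ← Finset.mul_sum, hθ.2, h.slope_self θ hθ] at h2
  linarith

theorem combo_le (h : QuadraticRisk R slope D σ) {θ θ' : Fin M → ℝ}
    (hθ : θ ∈ stdSimplex ℝ (Fin M)) (hθ' : θ' ∈ stdSimplex ℝ (Fin M)) {s : ℝ} (hs : 0 ≤ s)
    (hs1 : s ≤ 1) :
    R ((1 - s) • θ + s • θ') ≤ (1 - s) * R θ + s * R θ' - σ / 2 * (s * (1 - s)) * D θ θ' := by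
  have hm : (1 - s) • θ + s • θ' ∈ stdSimplex ℝ (Fin M) :=
    convex_stdSimplex ℝ _ hθ hθ' (by linarith) hs (by ring)
  have h1 := h.strong _ hm θ hθ
  have h2 := h.strong _ hm θ' hθ'
  have h0 := h.slope_self _ hm
  set m := (1 - s) • θ + s • θ' with hmd
  have e1 : D m θ = s ^ 2 * D θ θ' := by rw [h.comm, hmd, h.combo]
  have e2 : D m θ' = (1 - s) ^ 2 * D θ θ' := by
    rw [h.comm, hmd, h.comm θ θ', ← h.combo θ' θ (1 - s), add_comm, sub_sub_cancel]
  have e3 : ∑ j, m j * slope m j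
      = (1 - s) * ∑ j, θ j * slope m j + s * ∑ j, θ' j * slope m j := by
    rw [Finset.mul_sum, Finset.mul_sum, ← Finset.sum_add_distrib]
    refine Finset.sum_congr rfl fun j _ => ?_
    rw [show m j = (1 - s) * θ j + s * θ' j by simp [hmd]]
    ring
  rw [e1] at h1
  rw [e2] at h2
  rw [e3] at h0
  have h3 := mul_le_mul_of_nonneg_left h1 (sub_nonneg.2 hs1)
  have h4 := mul_le_mul_of_nonneg_left h2 hs
  linarith

/-- By `bias`, the variance is an affine function minus D(·, m). It is concave with exactly the
curvature of D, so adding κ times it lowers a convexity modulus by exactly κ. -/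
theorem variance_combo (h : QuadraticRisk R slope D σ) {θ θ' : Fin M → ℝ}
    (hθ : θ ∈ stdSimplex ℝ (Fin M)) (hθ' : θ' ∈ stdSimplex ℝ (Fin M)) {s : ℝ} (hs : 0 ≤ s)
    (hs1 : s ≤ 1) :
    ∑ j, ((1 - s) • θ + s • θ') j * D (vertex j) ((1 - s) • θ + s • θ')
      = (1 - s) * ∑ j, θ j * D (vertex j) θ + s * ∑ j, θ' j * D (vertex j) θ'
        + s * (1 - s) * D θ θ' := by
  have hm : (1 - s) • θ + s • θ' ∈ stdSimplex ℝ (Fin M) :=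
    convex_stdSimplex ℝ _ hθ hθ' (by linarith) hs (by ring)
  have h1 := h.bias θ hθ _ hm
  have h2 := h.bias θ' hθ' _ hm
  set m := (1 - s) • θ + s • θ' with hmd
  have e1 : D θ m = s ^ 2 * D θ θ' := by rw [hmd, h.combo]
  have e2 : D θ' m = (1 - s) ^ 2 * D θ θ' := by
    rw [hmd, h.comm θ θ', ← h.combo θ' θ (1 - s), add_comm, sub_sub_cancel]
  have e3 : ∑ j, m j * D (vertex j) m
      = (1 - s) * ∑ j, θ j * D (vertex j) m + s * ∑ j, θ' j * D (vertex j) m := by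
    rw [Finset.mul_sum, Finset.mul_sum, ← Finset.sum_add_distrib]
    refine Finset.sum_congr rfl fun j _ => ?_
    rw [show m j = (1 - s) * θ j + s * θ' j by simp [hmd]]
    ring
  rw [e3, h1, h2, e1, e2]
  ring

/-- A supporting affine function at each point suffices, and lower semicontinuity is enough for a
minimum on the compact simplex. -/
theorem lowerSemicontinuousOn (h : QuadraticRisk R slope D σ) (hσ : 0 ≤ σ) :
    LowerSemicontinuousOn R (stdSimplex ℝ (Fin M)) := by
  intro θ hθ y hy
  have hc : Continuous fun θ' : Fin M → ℝ => R θ + ∑ j, θ' j * slope θ j := by fun_prop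
  have h0 := hc.tendsto θ
  simp only [h.slope_self θ hθ, add_zero] at h0
  filter_upwards [(h0.eventually (lt_mem_nhds hy)).filter_mono nhdsWithin_le_nhds,
    self_mem_nhdsWithin] with θ' h1 h2
  have h3 := h.strong θ hθ θ' h2
  have h4 := mul_nonneg (by linarith : 0 ≤ σ / 2) (h.nonneg θ θ')
  linarith

/-- The penalized risk has a minimizer over the simplex, around which it grows quadratically. -/
theorem exists_minimizer (h : QuadraticRisk R slope D σ) (hσ : 0 ≤ σ) (hM : 0 < M) {ν κ : ℝ}
    (hν : ν ≤ 1) (k : Fin M → ℝ) :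
    ∃ θ₀ ∈ stdSimplex ℝ (Fin M), ∀ θ ∈ stdSimplex ℝ (Fin M),
      (1 - ν) * R θ₀ + ∑ j, θ₀ j * k j + κ * ∑ j, θ₀ j * D (vertex j) θ₀
        + ((1 - ν) * (σ / 2) - κ) * D θ₀ θ
      ≤ (1 - ν) * R θ + ∑ j, θ j * k j + κ * ∑ j, θ j * D (vertex j) θ := by
  have h1ν : 0 ≤ 1 - ν := sub_nonneg.2 hν
  set N : (Fin M → ℝ) → ℝ := fun θ =>
    (1 - ν) * R θ + ∑ j, θ j * k j + κ * ∑ j, θ j * D (vertex j) θ with hN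
  have hv : ContinuousOn (fun θ => ∑ j, θ j * k j + κ * ∑ j, θ j * D (vertex j) θ)
      (stdSimplex ℝ (Fin M)) := by
    -- Measuring distances from a fixed vertex, by `bias`, removes the double dependence of the
    -- variance on θ.
    have hc : ContinuousOn (fun θ : Fin M → ℝ => ∑ j, θ j * k j + κ * (∑ j, θ j * D (vertex j)
        (vertex ⟨0, hM⟩) - D θ (vertex ⟨0, hM⟩))) (stdSimplex ℝ (Fin M)) := by
      have := h.cont _ (vertex_mem ⟨0, hM⟩)
      fun_prop
    refine hc.congr fun θ hθ => ?_
    simp only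
    rw [h.bias θ hθ _ (vertex_mem ⟨0, hM⟩), add_sub_cancel_right]
  have hlsc : LowerSemicontinuousOn N (stdSimplex ℝ (Fin M)) := by
    have h1 : LowerSemicontinuousOn (fun θ => (1 - ν) * R θ) (stdSimplex ℝ (Fin M)) :=
      (continuous_const_mul (1 - ν)).comp_lowerSemicontinuousOn (h.lowerSemicontinuousOn hσ)
        (monotone_mul_left_of_nonneg h1ν)
    have h2 := h1.add hv.lowerSemicontinuousOn
    simpa only [hN, add_assoc] using h2
  obtain ⟨θ₀, hθ₀, hmin⟩ := hlsc.exists_isMinOn ⟨_, vertex_mem ⟨0, hM⟩⟩ (isCompact_stdSimplex ℝ _)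
  refine ⟨θ₀, hθ₀, fun θ hθ => ?_⟩
  change N θ₀ + ((1 - ν) * (σ / 2) - κ) * D θ₀ θ ≤ N θ
  -- Minimality is tested at the point a fraction s of the way from θ₀ to θ, and the inequality
  -- divided by s; letting s tend to 0 recovers the full growth constant.
  have hstep : ∀ s : ℝ, 0 < s → s ≤ 1 →
      N θ₀ + (1 - s) * (((1 - ν) * (σ / 2) - κ) * D θ₀ θ) ≤ N θ := by
    intro s hs hs1
    have hm : (1 - s) • θ₀ + s • θ ∈ stdSimplex ℝ (Fin M) :=
      convex_stdSimplex ℝ _ hθ₀ hθ (by linarith) hs.le (by ring)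
    have h1 : N θ₀ ≤ N ((1 - s) • θ₀ + s • θ) := hmin hm
    have h2 := mul_le_mul_of_nonneg_left (h.combo_le hθ₀ hθ hs.le hs1) h1ν
    have e3 : ∑ j, ((1 - s) • θ₀ + s • θ) j * k j
        = (1 - s) * ∑ j, θ₀ j * k j + s * ∑ j, θ j * k j := by
      rw [Finset.mul_sum, Finset.mul_sum, ← Finset.sum_add_distrib]
      refine Finset.sum_congr rfl fun j _ => ?_
      simp only [Pi.add_apply, Pi.smul_apply, smul_eq_mul]
      ring
    simp only [hN] at h1 ⊢
    rw [h.variance_combo hθ₀ hθ hs.le hs1, e3] at h1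
    refine le_of_mul_le_mul_left ?_ hs
    linarith
  refine le_of_forall_pos_le_add fun ε hε => ?_
  set x := ((1 - ν) * (σ / 2) - κ) * D θ₀ θ with hx
  have h1 := hstep (min 1 (ε / (|x| + 1))) (by positivity) (min_le_left _ _)
  have h2 : min 1 (ε / (|x| + 1)) * x ≤ ε := by
    calc min 1 (ε / (|x| + 1)) * x ≤ min 1 (ε / (|x| + 1)) * |x| := by
          gcongr
          exact le_abs_self x
      _ ≤ ε / (|x| + 1) * |x| := by gcongr; exact min_le_right _ _
      _ ≤ ε := by
          rw [div_mul_eq_mul_div, div_le_iff₀ (by positivity)]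
          nlinarith [abs_nonneg x]
  linarith

end QuadraticRisk

/-- Young's inequality for the product of the nuisance error and a power of the distance. -/
theorem two_mul_mul_rpow_le {γ μ e d : ℝ} (hγ : γ ∈ Set.Icc (0 : ℝ) 1) (hμ : 0 < μ) (he : 0 ≤ e)
    (hd : 0 ≤ d) :
    2 * (e * d ^ γ) ≤ 2 * ((1 / μ) ^ (γ / (2 - γ)) * e ^ (2 / (2 - γ))) + μ * d ^ 2 := by
  obtain ⟨h0, h1⟩ := hγ
  have h2 : 0 < 2 - γ := by linarith
  set X := (1 / μ) ^ (γ / (2 - γ)) * e ^ (2 / (2 - γ)) with hX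
  have hX0 : 0 ≤ X := by positivity
  -- With these weights the powers of μ cancel and the geometric mean is e d^γ. Doubling gives
  -- (2−γ)X + γμd², and 0 ≤ γ ≤ 1 finishes.
  have key := Real.geom_mean_le_arith_mean2_weighted (w₁ := (2 - γ) / 2) (w₂ := γ / 2)
    (p₁ := X) (p₂ := μ * d ^ 2) (by positivity) (by positivity) hX0 (by positivity) (by ring)
  have e1 : X ^ ((2 - γ) / 2) = (1 / μ) ^ (γ / 2) * e := by
    rw [hX, Real.mul_rpow (by positivity) (by positivity), ← Real.rpow_mul (by positivity),
      ← Real.rpow_mul he]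
    rw [show γ / (2 - γ) * ((2 - γ) / 2) = γ / 2 by field_simp,
      show 2 / (2 - γ) * ((2 - γ) / 2) = 1 by field_simp, Real.rpow_one]
  have e2 : (μ * d ^ 2) ^ (γ / 2) = μ ^ (γ / 2) * d ^ γ := by
    rw [Real.mul_rpow hμ.le (by positivity), ← Real.rpow_natCast, ← Real.rpow_mul hd]
    congr 2
    push_cast
    ring
  have e3 : (1 / μ) ^ (γ / 2) * μ ^ (γ / 2) = 1 := by
    rw [← Real.mul_rpow (by positivity) hμ.le, one_div_mul_cancel hμ.ne', Real.one_rpow]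
  rw [e1, e2] at key
  have e4 : (1 / μ) ^ (γ / 2) * e * (μ ^ (γ / 2) * d ^ γ) = e * d ^ γ := by
    rw [show (1 / μ) ^ (γ / 2) * e * (μ ^ (γ / 2) * d ^ γ)
      = (1 / μ) ^ (γ / 2) * μ ^ (γ / 2) * (e * d ^ γ) by ring, e3, one_mul]
  rw [e4] at key
  have h3 : 0 ≤ μ * d ^ 2 := by positivity
  nlinarith

end

/-! ### The risk of ensembles and the choice of temperature -/

section

variable {𝒵 𝒳 𝒢 : Type*} [MeasurableSpace 𝒵] {M : ℕ} {P : Measure 𝒵}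
  {X : 𝒵 → 𝒳} {l : 𝒵 → ℝ → 𝒢 → ℝ} {f : Fin M → 𝒳 → ℝ}

theorem ensemble_vertex (f : Fin M → 𝒳 → ℝ) (j : Fin M) (x : 𝒳) :
    ensemble f (vertex j) x = f j x := sum_vertex_mul j fun k => f k x

theorem abs_ensemble_le {θ : Fin M → ℝ} (hθ : θ ∈ stdSimplex ℝ (Fin M)) {x : 𝒳} {b : ℝ}
    (hx : ∀ j, |f j x| ≤ b) : |ensemble f θ x| ≤ b := abs_sum_mul_le hθ hx

theorem measurable_ensemble [MeasurableSpace 𝒳] (hX : Measurable X) (hf : ∀ j, Measurable (f j))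
    (θ : Fin M → ℝ) : Measurable fun z => ensemble f θ (X z) :=
  Finset.measurable_fun_sum _ fun j _ => ((hf j).comp hX).const_mul _

theorem ensembleDist_sq (P : Measure 𝒵) (X : 𝒵 → 𝒳) (f : Fin M → 𝒳 → ℝ) (θ θ' : Fin M → ℝ) :
    ensembleDist P X f θ θ' ^ 2 = ∫ z, (ensemble f θ (X z) - ensemble f θ' (X z)) ^ 2 ∂P :=
  Real.sq_sqrt (integral_nonneg fun _ => sq_nonneg _)

theorem integrable_ensemble_sub_sq [IsProbabilityMeasure P] [MeasurableSpace 𝒳]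
    (hX : Measurable X) (hf : ∀ j, Measurable (f j)) {b : ℝ} (hb : ∀ᵐ z ∂P, ∀ j, |f j (X z)| ≤ b)
    {θ θ' : Fin M → ℝ} (hθ : θ ∈ stdSimplex ℝ (Fin M)) (hθ' : θ' ∈ stdSimplex ℝ (Fin M)) :
    Integrable (fun z => (ensemble f θ (X z) - ensemble f θ' (X z)) ^ 2) P := by
  refine Integrable.of_bound (((measurable_ensemble hX hf θ).sub
    (measurable_ensemble hX hf θ')).pow_const 2).aestronglyMeasurable ((2 * b) ^ 2) ?_
  filter_upwards [hb] with z hz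
  rw [norm_pow]
  refine pow_le_pow_left₀ (norm_nonneg _) ?_ 2
  exact (abs_sub _ _).trans (by linarith [abs_ensemble_le hθ hz, abs_ensemble_le hθ' hz])

/-- The derivative is linear in the target prediction, so averaging the vertex slopes with weights
θ' gives the slope towards f_θ'. The facts on D reduce to pointwise algebra of squares, integrated.
-/
theorem quadraticRisk [IsProbabilityMeasure P] [MeasurableSpace 𝒳]
    (hX : Measurable X) (hf : ∀ j, Measurable (f j)) {b : ℝ} (hb : ∀ᵐ z ∂P, ∀ j, |f j (X z)| ≤ b)
    {g : 𝒢} (hint : ∀ θ ∈ stdSimplex ℝ (Fin M), Integrable (lossAt X l f θ g) P) {σ : ℝ}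
    (hsc : StronglyConvexInExpectation P X l f σ g) :
    QuadraticRisk (fun θ => risk P X l f θ g)
      (fun θ j => ∫ z, deriv (fun u => l z u g) (ensemble f θ (X z)) *
        (ensemble f (vertex j) (X z) - ensemble f θ (X z)) ∂P)
      (fun θ θ' => ensembleDist P X f θ θ' ^ 2) σ := by
  have hslope : ∀ θ ∈ stdSimplex ℝ (Fin M), ∀ θ' ∈ stdSimplex ℝ (Fin M),
      ∑ j, θ' j * ∫ z, deriv (fun u => l z u g) (ensemble f θ (X z)) *
        (ensemble f (vertex j) (X z) - ensemble f θ (X z)) ∂P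
      = ∫ z, deriv (fun u => l z u g) (ensemble f θ (X z)) *
        (ensemble f θ' (X z) - ensemble f θ (X z)) ∂P := by
    intro θ hθ θ' hθ'
    simp only [← integral_const_mul]
    rw [← integral_finsetSum _ fun j _ => ((hsc θ hθ _ (vertex_mem j)).2.1).const_mul _]
    refine integral_congr_ae (ae_of_all _ fun z => ?_)
    simp only [ensemble_vertex]
    have e : ∀ j, θ' j * (deriv (fun u => l z u g) (ensemble f θ (X z)) *
        (f j (X z) - ensemble f θ (X z))) = deriv (fun u => l z u g) (ensemble f θ (X z)) *
        (θ' j * f j (X z) - ensemble f θ (X z) * θ' j) := fun j => by ring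
    simp only [e, ← Finset.mul_sum, Finset.sum_sub_distrib, hθ'.2, mul_one]
    rfl
  refine ⟨fun _ _ => sq_nonneg _, fun θ => ?_, fun θ θ' => ?_, fun θ θ' s => ?_,
    fun θ hθ θ' hθ' => ?_, fun θ' hθ' => ?_, fun θ hθ => ?_, fun θ hθ θ' hθ' => ?_⟩
  · simp [ensembleDist_sq]
  · simp only [ensembleDist_sq]
    exact integral_congr_ae (ae_of_all _ fun z => by simp only; ring)
  · simp only [ensembleDist_sq]
    rw [← integral_const_mul]
    refine integral_congr_ae (ae_of_all _ fun z => ?_)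
    have e : ensemble f ((1 - s) • θ + s • θ') (X z)
        = (1 - s) * ensemble f θ (X z) + s * ensemble f θ' (X z) := by
      simp only [ensemble, Finset.mul_sum, ← Finset.sum_add_distrib]
      refine Finset.sum_congr rfl fun j _ => ?_
      simp only [Pi.add_apply, Pi.smul_apply, smul_eq_mul]
      ring
    simp only [e]
    ring
  · simp only [ensembleDist_sq, ← integral_const_mul]
    have hi : ∀ {θ θ' : Fin M → ℝ}, θ ∈ stdSimplex ℝ (Fin M) → θ' ∈ stdSimplex ℝ (Fin M) →
        Integrable (fun z => (ensemble f θ (X z) - ensemble f θ' (X z)) ^ 2) P :=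
      integrable_ensemble_sub_sq hX hf hb
    rw [← integral_finsetSum _ fun j _ => (hi (vertex_mem j) hθ').const_mul _,
      ← integral_finsetSum _ fun j _ => (hi (vertex_mem j) hθ).const_mul _,
      ← integral_add (integrable_finsetSum _ fun j _ => (hi (vertex_mem j) hθ).const_mul _)
        (hi hθ hθ')]
    refine integral_congr_ae (ae_of_all _ fun z => ?_)
    simp only [ensemble_vertex]
    set m := ensemble f θ (X z) with hm
    set c := ensemble f θ' (X z)
    have e : ∀ j, θ j * (f j (X z) - c) ^ 2 = θ j * (f j (X z) - m) ^ 2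
        + 2 * (m - c) * (θ j * f j (X z)) + (c ^ 2 - m ^ 2) * θ j := fun j => by ring
    have em : ∑ j, θ j * f j (X z) = m := rfl
    simp only [e, Finset.sum_add_distrib, ← Finset.mul_sum, em, hθ.2]
    ring
  · simp only [ensembleDist_sq]
    refine continuousOn_of_dominated (bound := fun _ => (2 * b) ^ 2) (fun θ _ =>
      (((measurable_ensemble hX hf θ).sub
        (measurable_ensemble hX hf θ')).pow_const 2).aestronglyMeasurable) (fun θ hθ => ?_)
      (integrable_const _) (ae_of_all _ fun z => ?_)
    · filter_upwards [hb] with z hz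
      rw [norm_pow]
      refine pow_le_pow_left₀ (norm_nonneg _) ?_ 2
      exact (abs_sub _ _).trans (by linarith [abs_ensemble_le hθ hz, abs_ensemble_le hθ' hz])
    · refine Continuous.continuousOn ?_
      unfold ensemble
      fun_prop
  · simp [hslope θ hθ θ hθ]
  · have h1 := (hsc θ hθ θ' hθ').2.2
    rw [integral_sub (hint θ' hθ') (hint θ hθ), ensembleDist_sq] at h1
    simp only [hslope θ hθ θ' hθ', ensembleDist_sq]
    have e : ∫ z, (ensemble f θ (X z) - ensemble f θ' (X z)) ^ 2 ∂P
        = ∫ z, (ensemble f θ' (X z) - ensemble f θ (X z)) ^ 2 ∂P :=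
      integral_congr_ae (ae_of_all _ fun z => by simp only; ring)
    rw [e]
    simp only [risk]
    linarith

/-- The deviation bound at the temperature dictated by the lower bounds on `β`. -/
theorem BoundedLipschitzFamily.exists_temperature [IsProbabilityMeasure P] {n : ℕ}
    {F : Fin M → 𝒵 → ℝ} {L : (Fin M → ℝ) → 𝒵 → ℝ} {b Cb : ℝ}
    (h : BoundedLipschitzFamily P F L b Cb) (hb : 0 ≤ b) {ν μ β : ℝ}
    (hν0 : 0 < ν) (hν1 : ν < 1) (hμ : 0 < μ)
    (hβ1 : 8 * Cb ^ 2 * (1 - ν) ^ 2 / μ ≤ β)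
    (hβ2 : 8 * Real.sqrt 3 * b * Cb * (1 - ν) ≤ β)
    (hβ3 : 2 * Cb * ν * (ν * Cb + μ * b) / μ ≤ β)
    {π : Fin M → ℝ} (hπ : ∀ j, 0 < π j) (hπ1 : ∑ j, π j = 1)
    {θ₀ : Fin M → ℝ} (hθ₀ : θ₀ ∈ stdSimplex ℝ (Fin M)) {δ : ℝ} (hδ : 0 < δ)
    {D : Fin M → ℝ} (hD : ∀ j, D j = ∫ w, (F j w - ∑ k, θ₀ k * F k w) ^ 2 ∂P) :
    ∃ τ : ℝ, 0 ≤ τ ∧ 2 * τ ≤ β ∧ 2 * τ ≤ 14 * max (1 / μ * Cb ^ 2) (b * Cb) ∧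
      (Measure.pi fun _ : Fin n => P) {z | ∃ θ ∈ stdSimplex ℝ (Fin M), 0 <
        empDev P (fun w => mixFamily L ν θ w - mixFamily L ν θ₀ w) z
        - n * (μ * (63 / 40 * ∑ j, θ j * D j
          + 19 / 20 * (∑ j, θ j * D j + ∑ j, θ₀ j * D j)))
        - τ * (∑ j, θ j * Real.log (1 / π j) + Real.log (1 / δ))} ≤ ENNReal.ofReal δ := by
  have h1ν : 0 < 1 - ν := by linarith
  have hmax0 : 0 ≤ max (1 / μ * Cb ^ 2) (b * Cb) := le_max_of_le_right (mul_nonneg hb h.nonneg)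
  have hνI : ν ∈ Set.Icc (0 : ℝ) 1 := ⟨hν0.le, hν1.le⟩
  -- If C_b = 0 the lower bounds on β may vanish and leave no positive s and t; but then the loss
  -- almost surely does not depend on the weights, there is no deviation, and τ = 0 works.
  rcases h.nonneg.eq_or_lt with hCb | hCb
  · subst hCb
    refine ⟨0, le_rfl, by simpa using hβ2, by simp, ?_⟩
    refine le_of_eq_of_le (measure_eq_zero_iff_ae_notMem.2 ?_) bot_le
    have hz0 : ∀ᵐ w ∂P, ∀ θ ∈ stdSimplex ℝ (Fin M),
        |mixFamily L ν θ w - mixFamily L ν θ₀ w| ≤ 0 := by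
      filter_upwards [h.lipschitz] with w hw θ hθ
      have h0 : ∀ θ' ∈ stdSimplex ℝ (Fin M), L θ' w = L θ₀ w := fun θ' hθ' => by
        have := hw θ' hθ' θ₀ hθ₀
        rw [zero_mul, abs_nonpos_iff, sub_eq_zero] at this
        exact this
      simp only [mixFamily, h0 θ hθ, h0 _ (vertex_mem _), ← Finset.sum_mul, hθ.2, hθ₀.2]
      simp
    filter_upwards [ae_pi_forall hz0] with z hz
    rintro ⟨θ, hθ, hpos⟩
    have h1 := abs_empDev_le (P := P) (n := n)
      (h := fun w => mixFamily L ν θ w - mixFamily L ν θ₀ w) (c := 0)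
      (by filter_upwards [hz0] with w hw using hw θ hθ) (fun k => hz k θ hθ)
    rw [mul_zero, mul_zero, abs_nonpos_iff] at h1
    have hD0 : ∀ l, 0 ≤ D l := fun l => by rw [hD]; exact integral_nonneg fun w => sq_nonneg _
    have h2 : 0 ≤ ∑ j, θ j * D j := Finset.sum_nonneg fun j _ => mul_nonneg (hθ.1 j) (hD0 j)
    have h3 : 0 ≤ ∑ j, θ₀ j * D j := Finset.sum_nonneg fun j _ => mul_nonneg (hθ₀.1 j) (hD0 j)
    rw [h1] at hpos
    have h4 : 0 ≤ n * (μ * (63 / 40 * ∑ j, θ j * D j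
          + 19 / 20 * (∑ j, θ j * D j + ∑ j, θ₀ j * D j))) := by positivity
    linarith
  -- The maximum m is used in place of β, which may be arbitrarily large and must not enter the log
  -- (1/δ) term.
  · set m := max (8 * Cb ^ 2 * (1 - ν) ^ 2 / μ) (max (8 * Real.sqrt 3 * b * Cb * (1 - ν))
      (2 * Cb * ν * (ν * Cb + μ * b) / μ)) with hm
    have m1 : 8 * Cb ^ 2 * (1 - ν) ^ 2 / μ ≤ m := le_max_left _ _
    have m2 : 8 * Real.sqrt 3 * b * Cb * (1 - ν) ≤ m :=
      (le_max_left _ _).trans (le_max_right _ _)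
    have m3 : 2 * Cb * ν * (ν * Cb + μ * b) / μ ≤ m :=
      (le_max_right _ _).trans (le_max_right _ _)
    have hm0 : 0 < m := lt_of_lt_of_le (by positivity) m1
    rw [div_le_iff₀ hμ] at m1 m3
    have hs3 : Real.sqrt 3 ^ 2 = 3 := Real.sq_sqrt (by norm_num)
    -- With s = m/5 and t = 3m/10, the bounds `m1`, `m2`, `m3` become exactly the requirements
    -- `hs2`, `hs1`, `ht2`, and 2τ = m.
    refine ⟨1 / 5 * m + 3 / 10 * m, by positivity, ?_, ?_,
      h.measure_excess_le hb hνI hμ (by positivity) (by positivity) ?_ ?_ ?_ ?_ hπ hπ1 hθ₀ hδ hD⟩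
    · have : m ≤ β := max_le hβ1 (max_le hβ2 hβ3)
      linarith
    · have : m ≤ 14 * max (1 / μ * Cb ^ 2) (b * Cb) := by
        have k1 : 1 / μ * Cb ^ 2 ≤ max (1 / μ * Cb ^ 2) (b * Cb) := le_max_left _ _
        have k2 : b * Cb ≤ max (1 / μ * Cb ^ 2) (b * Cb) := le_max_right _ _
        have n1 : 0 ≤ 1 / μ * Cb ^ 2 := by positivity
        have n2 : 0 ≤ b * Cb := by positivity
        have q1 : (1 - ν) ^ 2 ≤ 1 := by nlinarith
        have q2 : ν ^ 2 ≤ 1 := by nlinarith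
        refine max_le ?_ (max_le ?_ ?_)
        · calc 8 * Cb ^ 2 * (1 - ν) ^ 2 / μ = 8 * (1 / μ * Cb ^ 2) * (1 - ν) ^ 2 := by ring
            _ ≤ 8 * (1 / μ * Cb ^ 2) * 1 := by gcongr
            _ ≤ _ := by linarith
        · have hs : Real.sqrt 3 ≤ 7 / 4 := by
            rw [Real.sqrt_le_left (by norm_num)]; norm_num
          calc 8 * Real.sqrt 3 * b * Cb * (1 - ν) = 8 * Real.sqrt 3 * (b * Cb) * (1 - ν) := by ring
            _ ≤ 8 * (7 / 4) * (b * Cb) * 1 := by gcongr; linarith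
            _ ≤ _ := by linarith
        · calc 2 * Cb * ν * (ν * Cb + μ * b) / μ
              = 2 * (1 / μ * Cb ^ 2) * ν ^ 2 + 2 * (b * Cb) * ν := by field_simp
            _ ≤ 2 * (1 / μ * Cb ^ 2) * 1 + 2 * (b * Cb) * 1 := by gcongr
            _ ≤ _ := by linarith
      linarith
    · have h0 : 0 ≤ 8 * Real.sqrt 3 * b * Cb * (1 - ν) := by positivity
      have := pow_le_pow_left₀ h0 m2 2
      rw [show (8 * Real.sqrt 3 * b * Cb * (1 - ν)) ^ 2
        = 64 * Real.sqrt 3 ^ 2 * ((1 - ν) * Cb * b) ^ 2 by ring, hs3] at this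
      linarith
    · linarith
    · have h1 : 0 < 2 * (ν * Cb) ^ 2 := by positivity
      have h2 : μ * (2 * (ν * Cb * b)) < μ * m := by linarith
      have h3 := lt_of_mul_lt_mul_left h2 hμ.le
      linarith
    · linarith

end

end QAgg

/-! ### The oracle inequality -/

theorem theorem3 :
    ∃ C : ℝ, 0 < C ∧
      ∀ (𝒵 𝒳 𝒢 Ω : Type*) [MeasurableSpace 𝒵] [MeasurableSpace 𝒳] [MeasurableSpace Ω]
        (P : Measure 𝒵) [IsProbabilityMeasure P] (Q : Measure Ω) [IsProbabilityMeasure Q]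
        (n M : ℕ) (_ : 0 < n)
        -- the i.i.d. sample `S 0, …, S (n - 1)` with law `P`
        (S : Fin n → Ω → 𝒵) (_ : ∀ i, Measurable (S i)) (_ : ∀ i, Q.map (S i) = P)
        (_ : iIndepFun S Q)
        -- covariate, candidate functions, loss, true and estimated nuisance
        (X : 𝒵 → 𝒳) (_ : Measurable X) (f : Fin M → 𝒳 → ℝ) (_ : ∀ j, Measurable (f j))
        (l : 𝒵 → ℝ → 𝒢 → ℝ) (g₀ ĝ : 𝒢)
        (_ : ∀ θ ∈ stdSimplex ℝ (Fin M), Integrable (lossAt X l f θ g₀) P)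
        (_ : ∀ θ ∈ stdSimplex ℝ (Fin M), AEStronglyMeasurable (lossAt X l f θ ĝ) P)
        -- prior weights
        (π : Fin M → ℝ) (_ : ∀ j, 0 < π j) (_ : ∑ j, π j = 1)
        (Cb Error : 𝒢 → ℝ) (_ : 0 ≤ Cb ĝ) (_ : 0 ≤ Error ĝ)
        (b σ ν μ β γ : ℝ) (_ : 0 < σ) (_ : ν ∈ Set.Icc (0 : ℝ) 1) (_ : γ ∈ Set.Icc (0 : ℝ) 1)
        -- the effect of the nuisance error on the mixed loss
        (_ : ∀ θ ∈ stdSimplex ℝ (Fin M), ∀ θ' ∈ stdSimplex ℝ (Fin M),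
          ∫ z, (mixedLoss X l f ν θ g₀ z - mixedLoss X l f ν θ' g₀ z) ∂P
            - ∫ z, (mixedLoss X l f ν θ ĝ z - mixedLoss X l f ν θ' ĝ z) ∂P
          ≤ Error ĝ * ensembleDist P X f θ θ' ^ γ)
        (_ : StronglyConvexInExpectation P X l f σ g₀)
        -- the loss at `ĝ` is Lipschitz in the prediction
        (_ : ∀ᵐ z ∂P, ∀ θ ∈ stdSimplex ℝ (Fin M), ∀ θ' ∈ stdSimplex ℝ (Fin M),
          |lossAt X l f θ ĝ z - lossAt X l f θ' ĝ z|
            ≤ Cb ĝ * |ensemble f θ (X z) - ensemble f θ' (X z)|)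
        -- the loss at `ĝ` and the candidates are bounded
        (_ : ∀ᵐ z ∂P, ∀ θ ∈ stdSimplex ℝ (Fin M), |lossAt X l f θ ĝ z| ≤ b)
        (_ : ∀ᵐ z ∂P, ∀ j, |f j (X z)| ≤ b)
        (_ : 0 < μ) (_ : μ ≤ min ν (1 - ν) * (σ / 14))
        (_ : 8 * Cb ĝ ^ 2 * (1 - ν) ^ 2 / μ ≤ β)
        (_ : 8 * Real.sqrt 3 * b * Cb ĝ * (1 - ν) ≤ β)
        (_ : 2 * Cb ĝ * ν * (ν * Cb ĝ + μ * b) / μ ≤ β)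
        -- the Q-aggregation ensemble
        (θhat : Ω → Fin M → ℝ)
        (_ : ∀ᵐ ω ∂Q, IsQAggregate X l f ν β π ĝ (fun i => S i ω) (θhat ω))
        (δ : ℝ) (_ : 0 < δ) (_ : δ < 1),
        -- an event of probability at least `1 - δ` on which the oracle inequality holds
        ∃ A : Set Ω, MeasurableSet A ∧ ENNReal.ofReal (1 - δ) ≤ Q A ∧ ∀ ω ∈ A,
          risk P X l f (θhat ω) g₀
            ≤ (⨅ j : Fin M, (risk P X l f (vertex j) g₀
                + β / (n : ℝ) * Real.log (1 / π j)))
              + C * (Real.log (1 / δ) * max (1 / μ * Cb ĝ ^ 2) (b * Cb ĝ) / (n : ℝ))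
              + 2 * ((1 / μ) ^ (γ / (2 - γ)) * Error ĝ ^ (2 / (2 - γ))) := by

  -- The constant comes from 8√3 ≤ 8 · 7/4 = 14 in `exists_temperature`.
  refine ⟨14, by norm_num, ?_⟩
  intro 𝒵 𝒳 𝒢 Ω _ _ _ P _ Q _ n M hn S hS hlaw hind X hX f hf l g₀ ĝ hint hmeas π hπ hπ1 Cb Error
    hCb hErr b σ ν μ β γ hσ hν hγ hnuis hsc hlip hloss hcand hμ hμσ hβ1 hβ2 hβ3 θhat hθhat δ hδ hδ1
  have hM : 0 < M := by
    rcases Nat.eq_zero_or_pos M with rfl | h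
    · simp at hπ1
    · exact h
  have hb : 0 ≤ b := by
    obtain ⟨z, hz⟩ := hcand.exists
    exact (abs_nonneg _).trans (hz ⟨0, hM⟩)
  have hmin : 0 < min ν (1 - ν) := by
    have h1 : 0 < min ν (1 - ν) * (σ / 14) := hμ.trans_le hμσ
    exact pos_of_mul_pos_left h1 (by positivity)
  have hν0 : 0 < ν := hmin.trans_le (min_le_left _ _)
  have hν1 : ν < 1 := by linarith [hmin.trans_le (min_le_right ν (1 - ν))]
  have hμν : 7 * μ ≤ ν * (σ / 2) := by
    have : min ν (1 - ν) * (σ / 14) ≤ ν * (σ / 14) :=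
      mul_le_mul_of_nonneg_right (min_le_left _ _) (by positivity)
    linarith
  have hμν' : 7 * μ ≤ (1 - ν) * (σ / 2) := by
    have : min ν (1 - ν) * (σ / 14) ≤ (1 - ν) * (σ / 14) :=
      mul_le_mul_of_nonneg_right (min_le_right _ _) (by positivity)
    linarith
  have hn' : (0 : ℝ) < n := by exact_mod_cast hn
  have hfam : BoundedLipschitzFamily P (fun j z => f j (X z)) (fun θ => lossAt X l f θ ĝ) b (Cb ĝ) :=
    ⟨fun j => ((hf j).comp hX).aestronglyMeasurable, hcand, hmeas, hCb, hlip, hloss⟩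
  have hquad := quadraticRisk hX hf hcand hint hsc
  -- The value of κ is the coefficient of V(θ₀) in the deviation bound.
  obtain ⟨θ₀, hθ₀, hgrow⟩ := hquad.exists_minimizer hσ.le hM (ν := ν) (κ := 19 / 20 * μ) hν1.le
    (fun j => ν * risk P X l f (vertex j) g₀ + β / n * Real.log (1 / π j))
  obtain ⟨τ, hτ0, hτβ, hτmax, hdev⟩ := hfam.exists_temperature (n := n) hb hν0 hν1 hμ hβ1 hβ2 hβ3 hπ
    hπ1 hθ₀ hδ (D := fun j => ensembleDist P X f (vertex j) θ₀ ^ 2) (fun j => by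
      rw [ensembleDist_sq]
      simp only [ensemble_vertex]
      rfl)
  set B : Set (Fin n → 𝒵) := {z | ∃ θ ∈ stdSimplex ℝ (Fin M), 0 <
        empDev P (fun w => mixFamily (fun θ => lossAt X l f θ ĝ) ν θ w
          - mixFamily (fun θ => lossAt X l f θ ĝ) ν θ₀ w) z
        - n * (μ * (63 / 40 * ∑ j, θ j * ensembleDist P X f (vertex j) θ₀ ^ 2
          + 19 / 20 * (∑ j, θ j * ensembleDist P X f (vertex j) θ₀ ^ 2
            + ∑ j, θ₀ j * ensembleDist P X f (vertex j) θ₀ ^ 2)))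
        - τ * (∑ j, θ j * Real.log (1 / π j) + Real.log (1 / δ))} with hB
  have hmap : Q.map (fun ω i => S i ω) = Measure.pi fun _ : Fin n => P := by
    rw [(iIndepFun_iff_map_fun_eq_pi_map fun i => (hS i).aemeasurable).1 hind]
    simp only [hlaw]
  -- B is an uncountable union with no measurability at hand, so a measurable hull of the same
  -- measure replaces it; likewise for N below.
  set T : Set (Fin n → 𝒵) := toMeasurable (Measure.pi fun _ : Fin n => P) B with hT
  have hSm : Measurable fun ω i => S i ω := measurable_pi_lambda _ hS
  have hQB : Q ((fun ω i => S i ω) ⁻¹' T) ≤ ENNReal.ofReal δ := by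
    rw [← Measure.map_apply hSm (measurableSet_toMeasurable _ _), hmap, measure_toMeasurable]
    exact hdev
  set N : Set Ω := toMeasurable Q {ω | ¬ IsQAggregate X l f ν β π ĝ (fun i => S i ω) (θhat ω)}
    with hN
  have hQN : Q N = 0 := by rw [measure_toMeasurable]; exact hθhat
  refine ⟨((fun ω i => S i ω) ⁻¹' T ∪ N)ᶜ, ((hSm (measurableSet_toMeasurable _ _)).union
    (measurableSet_toMeasurable _ _)).compl, ?_, ?_⟩
  · rw [prob_compl_eq_one_sub ((hSm (measurableSet_toMeasurable _ _)).union
      (measurableSet_toMeasurable _ _)), ENNReal.ofReal_sub _ hδ.le, ENNReal.ofReal_one]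
    exact tsub_le_tsub_left ((measure_union_le _ _).trans (by rw [hQN, add_zero]; exact hQB)) 1
  intro ω hω
  rw [Set.mem_compl_iff, Set.mem_union, not_or] at hω
  have hagg : IsQAggregate X l f ν β π ĝ (fun i => S i ω) (θhat ω) := by
    by_contra hcon
    exact hω.2 (subset_toMeasurable _ _ hcon)
  obtain ⟨hθ, hopt⟩ := hagg
  have hexc : (fun i => S i ω) ∉ B := fun hmem => hω.1 (subset_toMeasurable _ _ hmem)
  simp only [hB, Set.mem_ofPred_eq] at hexc
  push Not at hexc
  set θ := θhat ω
  set z : Fin n → 𝒵 := fun i => S i ω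
  replace hexc := hexc θ hθ
  replace hopt : qObjective X l f ν β π ĝ z θ ≤ qObjective X l f ν β π ĝ z θ₀ := hopt hθ₀
  have hmix : ∀ θ ∈ stdSimplex ℝ (Fin M), Integrable (mixedLoss X l f ν θ g₀) P := fun θ hθ =>
    ((hint θ hθ).const_mul _).add ((integrable_finsetSum _ fun j _ =>
      (hint _ (vertex_mem j)).const_mul _).const_mul _)
  have hmixrisk : ∀ θ ∈ stdSimplex ℝ (Fin M), ∫ w, mixedLoss X l f ν θ g₀ w ∂P
      = (1 - ν) * risk P X l f θ g₀ + ν * ∑ j, θ j * risk P X l f (vertex j) g₀ := fun θ hθ => by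
    simp only [mixedLoss]
    rw [integral_add ((hint θ hθ).const_mul _) ((integrable_finsetSum _ fun j _ =>
      (hint _ (vertex_mem j)).const_mul _).const_mul _), integral_const_mul, integral_const_mul,
      integral_finsetSum _ fun j _ => (hint _ (vertex_mem j)).const_mul _]
    simp only [integral_const_mul, risk]
  have hshift := hnuis θ hθ θ₀ hθ₀
  rw [integral_sub (hmix θ hθ) (hmix θ₀ hθ₀), hmixrisk θ hθ, hmixrisk θ₀ hθ₀] at hshift
  have hyoung := two_mul_mul_rpow_le hγ hμ hErr (Real.sqrt_nonneg
    (∫ z, (ensemble f θ (X z) - ensemble f θ₀ (X z)) ^ 2 ∂P))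
  change 2 * (Error ĝ * ensembleDist P X f θ θ₀ ^ γ) ≤ _ + μ * ensembleDist P X f θ θ₀ ^ 2 at hyoung
  have hgθ := hgrow θ hθ
  have hsplit : ∀ θ : Fin M → ℝ, ∑ j, θ j * (ν * risk P X l f (vertex j) g₀
      + β / n * Real.log (1 / π j)) = ν * ∑ j, θ j * risk P X l f (vertex j) g₀
        + β / n * ∑ j, θ j * Real.log (1 / π j) := fun θ => by
    rw [Finset.mul_sum, Finset.mul_sum, ← Finset.sum_add_distrib]
    exact Finset.sum_congr rfl fun j _ => by ring
  have hvar := hquad.add_variance_le hθ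
  have hbias := hquad.bias θ hθ θ₀ hθ₀
  have hd0 := hquad.nonneg θ θ₀
  have hcomm := hquad.comm θ₀ θ
  have hself := hquad.self
  have hV0 : 0 ≤ ∑ j, θ j * ensembleDist P X f (vertex j) θ ^ 2 :=
    Finset.sum_nonneg fun j _ => mul_nonneg (hθ.1 j) (sq_nonneg _)
  have hK0 : 0 ≤ ∑ j, θ j * Real.log (1 / π j) := by
    refine Finset.sum_nonneg fun j _ => mul_nonneg (hθ.1 j) (Real.log_nonneg ?_)
    rw [le_div_iff₀ (hπ j), one_mul, ← hπ1]
    exact Finset.single_le_sum (fun k _ => (hπ k).le) (Finset.mem_univ j)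
  rw [hbias] at hexc
  rw [hsplit, hsplit, hcomm] at hgθ
  have hemp : empDev P (fun w => mixFamily (fun θ => lossAt X l f θ ĝ) ν θ w
      - mixFamily (fun θ => lossAt X l f θ ĝ) ν θ₀ w) z
      = n * ∫ w, (mixedLoss X l f ν θ ĝ w - mixedLoss X l f ν θ₀ ĝ w) ∂P
        - (∑ i, mixedLoss X l f ν θ ĝ (z i) - ∑ i, mixedLoss X l f ν θ₀ ĝ (z i)) := by
    rw [empDev, Finset.sum_sub_distrib, Finset.sum_sub_distrib]
    simp only [Finset.sum_const, Finset.card_univ, Fintype.card_fin, nsmul_eq_mul]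
    rfl
  rw [hemp] at hexc
  simp only [qObjective] at hopt
  set I := ∫ w, (mixedLoss X l f ν θ ĝ w - mixedLoss X l f ν θ₀ ĝ w) ∂P
  set K := ∑ j, θ j * Real.log (1 / π j)
  set K₀ := ∑ j, θ₀ j * Real.log (1 / π j)
  set V := ∑ j, θ j * ensembleDist P X f (vertex j) θ ^ 2
  set V₀ := ∑ j, θ₀ j * ensembleDist P X f (vertex j) θ₀ ^ 2
  set d := ensembleDist P X f θ θ₀ ^ 2
  set A := ∑ i, mixedLoss X l f ν θ ĝ (z i)
  set A₀ := ∑ i, mixedLoss X l f ν θ₀ ĝ (z i)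
  have hstoch : I ≤ μ * (63 / 40 * (V + d) + 19 / 20 * (V + d + V₀))
      + τ / n * (K + Real.log (1 / δ)) + β / n * (K₀ - K) := by
    have h1 : n * (1 / (n : ℝ) * (A - A₀)) = A - A₀ := by field_simp
    have h2 : n * I ≤ n * (μ * (63 / 40 * (V + d) + 19 / 20 * (V + d + V₀))
      + τ / n * (K + Real.log (1 / δ)) + β / n * (K₀ - K)) := by
      have h3 := mul_le_mul_of_nonneg_left hopt hn'.le
      have h4 : n * (τ / n * (K + Real.log (1 / δ))) = τ * (K + Real.log (1 / δ)) := by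
        field_simp
      linarith
    exact le_of_mul_le_mul_left h2 hn'
  have hKτ : 2 * (τ / n) * K ≤ β / n * K := by
    refine mul_le_mul_of_nonneg_right ?_ hK0
    rw [mul_div_assoc']
    gcongr
  have hlogδ : 2 * (τ / n) * Real.log (1 / δ)
      ≤ 14 * (Real.log (1 / δ) * max (1 / μ * Cb ĝ ^ 2) (b * Cb ĝ) / n) := by
    have h0 : 0 ≤ Real.log (1 / δ) := Real.log_nonneg (by rw [le_div_iff₀ hδ]; linarith)
    calc 2 * (τ / n) * Real.log (1 / δ) = 2 * τ * Real.log (1 / δ) / n := by ring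
      _ ≤ 14 * max (1 / μ * Cb ĝ ^ 2) (b * Cb ĝ) * Real.log (1 / δ) / n := by gcongr
      _ = _ := by ring
  have hVν : 7 * μ * V ≤ ν * (σ / 2) * V := mul_le_mul_of_nonneg_right hμν hV0
  have hdν : 7 * μ * d ≤ (1 - ν) * (σ / 2) * d := mul_le_mul_of_nonneg_right hμν' hd0
  have hvarν := mul_le_mul_of_nonneg_left hvar hν0.le
  -- At a vertex the variance is zero and the mixed risk equals the risk; the growth term is
  -- dropped.
  have horacle : (1 - ν) * risk P X l f θ₀ g₀ + (ν * ∑ j, θ₀ j * risk P X l f (vertex j) g₀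
      + β / n * K₀) + 19 / 20 * μ * V₀
      ≤ ⨅ j : Fin M, (risk P X l f (vertex j) g₀ + β / n * Real.log (1 / π j)) := by
    have : Nonempty (Fin M) := ⟨⟨0, hM⟩⟩
    refine le_ciInf fun j => ?_
    have h1 := hgrow _ (vertex_mem j)
    rw [hsplit] at h1
    simp only [sum_vertex_mul, hself] at h1
    have h2 : 0 ≤ ((1 - ν) * (σ / 2) - 19 / 20 * μ) * ensembleDist P X f θ₀ (vertex j) ^ 2 :=
      mul_nonneg (by linarith) (sq_nonneg _)
    linarith
  have hμV : 0 ≤ μ * V := mul_nonneg hμ.le hV0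
  -- Count for 2Δ − Δ: μd has coefficient 101/20 + 1 − 121/20 = 0, the 1 being Young's term; μV has
  -- 101/20 + 19/20 = 6, at most the 7 supplied by `hVν`; μV₀ has 19/10 − 19/20 = 19/20, absorbed in
  -- `horacle`; and 2τK/n is paid by `hKτ`.
  linarith
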